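/- Let $n\ge 2$ and let $\mathcal O_n$ be the Cuntz algebra, the universal $C^*$-algebra generated by $n$ isometries $S_1,\dots,S_n$ with $\sum_i S_iS_i^*=1$. For a unitary $v\in\mathcal O_n$ let $\lambda_v$ be the unital $*$-endomorphism of $\mathcal O_n$ with $\lambda_v(S_i)=vS_i$ for all $i$. Let $\mathcal F_n^k$ be the linear span of the elements $S_{\mu_1}\cdots S_{\mu_k}S_{\nu_k}^*\cdots S_{\nu_1}^*$, let $\mathcal F_n$ be the norm closure of $\bigcup_k\mathcal F_n^k$, and put $\varphi(x)=\sum_i S_ixS_i^*$. Identify $\mathcal F_n$ with $\bigotimes_{i=1}^\infty M_n$, so that $a_1\otimes\cdots\otimes a_k\otimes 1\otimes\cdots = a_1\varphi(a_2)\cdots\varphi^{k-1}(a_k)$ for $a_1,\dots,a_k\in\mathcal F_n^1\cong M_n$. For a sequence $u=(u_k)_{k\ge1}$ of unitaries of $\mathcal F_n^1$ let $\alpha_u=\bigotimes_i \mathrm{Ad}(u_i)$ be the automorphism of $\mathcal F_n$ whose restriction to $\mathcal F_n^k$ is $\mathrm{Ad}(u_1\otimes\cdots\otimes u_k)$ for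 every $k$, and consider the limit in norm $$\lim_{k\to\infty} u_1\otimes u_2u_1^*\otimes u_3u_2^*\otimes\cdots\otimes u_{k+1}u_k^*\otimes 1\otimes 1\otimes\cdots. \qquad (*)$$ (a) For every such sequence $u$, if the limit $(*)$ exists in $\mathcal F_n$, then its value $v$ is a unitary of $\mathcal F_n$, and $\lambda_v$ is an automorphism of $\mathcal O_n$ whose restriction to $\mathcal F_n$ is $\alpha_u$. (b) For every such sequence $u$, if $\alpha_u$ extends to a unital $*$-endomorphism of $\mathcal O_n$, then there are real numbers $(\theta_k)_{k\ge1}$ such that the limit $(*)$ formed with $u_k'=e^{i\theta_k}u_k$ in place of $u_k$ exists in $\mathcal F_n$. (c) Let $\mathrm{Aut}(\mathcal O_n,\mathcal F_n)$ be the group of $*$-automorphisms of $\mathcal O_n$ that map $\mathcal F_n$ onto itself. The restriction map $\mathrm{Aut}(\mathcal O_n,\mathcal F_n)\to\mathrm{Aut}(\mathcal F_n)$ is not surjective. -/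

import Mathlib

open Filter Topology
open scoped ENNReal

namespace Cuntz

noncomputable section

/-! ## The Cuntz algebra -/

/-- `n` isometries in a unital C*-algebra whose range projections sum up to `1`. -/
structure IsCuntzFamily {n : ℕ} {A : Type*} [CStarAlgebra A] (T : Fin n → A) : Prop where
  isometry : ∀ i, star (T i) * T i = 1
  sum_range : ∑ i, T i * star (T i) = 1

theorem IsCuntzFamily.star_mul_of_ne {n : ℕ} {A : Type*} [CStarAlgebra A] {T : Fin n → A}
    (hT : IsCuntzFamily T) {i j : Fin n} (hij : i ≠ j) : star (T i) * T j = 0 := by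
  -- the positive elements `x k = star y k * y k`, `y k = star (T k) * T j`, sum to `1`
  let _ := CStarAlgebra.spectralOrder A
  let _ := CStarAlgebra.spectralOrderedRing A
  have h1 : ∑ k, star (star (T k) * T j) * (star (T k) * T j) = 1 := by
    have : ∀ k, star (star (T k) * T j) * (star (T k) * T j)
        = star (T j) * (T k * star (T k)) * T j := by
      intro k; simp [mul_assoc]
    simp_rw [this, ← Finset.sum_mul, ← Finset.mul_sum, hT.sum_range, mul_one, hT.isometry]
  have h2 : ∑ k ∈ Finset.univ.erase j, star (star (T k) * T j) * (star (T k) * T j) = 0 := by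
    rw [← Finset.add_sum_erase _ _ (Finset.mem_univ j)] at h1
    rw [hT.isometry, star_one, mul_one] at h1
    exact add_eq_left.1 h1
  have h3 := (Finset.sum_eq_zero_iff_of_nonneg (fun k _ => star_mul_self_nonneg _)).1 h2 i
    (by simp [hij])
  exact CStarRing.star_mul_self_eq_zero_iff _ |>.1 h3

/-- A nonzero unital C*-algebra together with a Cuntz family of `n` isometries. Carriers in `Type`
are enough: a C*-algebra generated by `n` elements is separable, so it has at most continuum
cardinality. -/
structure Model (n : ℕ) where
  carrier : Type
  [cstar : CStarAlgebra carrier]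
  [nontriv : Nontrivial carrier]
  gen : Fin n → carrier
  isCuntz : IsCuntzFamily gen

attribute [instance] Model.cstar Model.nontriv

/-- The C*-algebra of bounded families indexed by all Cuntz families. -/
abbrev Product (n : ℕ) : Type 1 := lp (fun ρ : Model n => ρ.carrier) ∞

instance (n : ℕ) : CStarAlgebra (Product n) where

theorem norm_le_one_of_isometry {A : Type*} [CStarAlgebra A] {a : A} (h : star a * a = 1) :
    ‖a‖ ≤ 1 := by
  have h1 : ‖a‖ * ‖a‖ = ‖(1 : A)‖ := by rw [← CStarRing.norm_star_mul_self, h]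
  have h2 : ‖(1 : A)‖ ≤ 1 := by
    cases subsingleton_or_nontrivial A
    · simp [Subsingleton.elim (1 : A) 0]
    · simp
  nlinarith [norm_nonneg a]

/-- The universal generator: its `ρ`-th coordinate is the `i`-th isometry of `ρ`. -/
def prodGen (n : ℕ) (i : Fin n) : Product n :=
  ⟨fun ρ => ρ.gen i, memℓp_infty ⟨1, by
    rintro _ ⟨ρ, rfl⟩
    exact norm_le_one_of_isometry (ρ.isCuntz.isometry i)⟩⟩

/-- The C*-subalgebra generated by the universal generators. -/
def prodSub (n : ℕ) : StarSubalgebra ℂ (Product n) :=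
  (StarAlgebra.adjoin ℂ (Set.range (prodGen n))).topologicalClosure

end

end Cuntz

/-- The Cuntz algebra `𝒪ₙ`: the universal C*-algebra generated by `n` isometries whose ranges sum
up to `1`, realized by letting the generators run through all Cuntz families at once. -/
def CuntzAlgebra (n : ℕ) : Type 1 := Cuntz.prodSub n

namespace Cuntz

noncomputable section

instance (n : ℕ) : IsClosed (prodSub n : Set (Product n)) :=
  StarSubalgebra.isClosed_topologicalClosure _

instance (n : ℕ) : CStarAlgebra (CuntzAlgebra n) :=
  inferInstanceAs (CStarAlgebra (prodSub n))

/-- The inclusion of the Cuntz algebra in the product. -/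
def incl (n : ℕ) : CuntzAlgebra n →⋆ₐ[ℂ] Product n := (prodSub n).subtype

theorem incl_isometry (n : ℕ) : Isometry (incl n) := isometry_subtype_coe

theorem incl_injective (n : ℕ) : Function.Injective (incl n) := (incl_isometry n).injective

/-- The canonical generating isometries `S i` of the Cuntz algebra. -/
def S {n : ℕ} (i : Fin n) : CuntzAlgebra n :=
  ⟨prodGen n i, StarSubalgebra.le_topologicalClosure _
    (StarAlgebra.subset_adjoin ℂ _ ⟨i, rfl⟩)⟩

@[simp] theorem incl_S {n : ℕ} (i : Fin n) : incl n (S i) = prodGen n i := rfl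

theorem isCuntzFamily_S (n : ℕ) : IsCuntzFamily (S : Fin n → CuntzAlgebra n) where
  isometry i := by
    apply incl_injective n
    rw [map_mul, map_star, map_one, incl_S]
    ext ρ
    exact ρ.isCuntz.isometry i
  sum_range := by
    apply incl_injective n
    rw [map_sum, map_one]
    simp_rw [map_mul, map_star, incl_S]
    ext ρ
    rw [lp.coeFn_sum, Finset.sum_apply]
    exact ρ.isCuntz.sum_range

/-- A closed star subalgebra that contains the generators is everything. -/
theorem eq_top_of_closed {n : ℕ} (B : StarSubalgebra ℂ (CuntzAlgebra n))
    (hB : IsClosed (B : Set (CuntzAlgebra n))) (hS : ∀ i, S i ∈ B) : B = ⊤ := by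
  have hcl : IsClosed ((B.map (incl n) : StarSubalgebra ℂ (Product n)) : Set (Product n)) := by
    have : Topology.IsClosedEmbedding (incl n) :=
      (incl_isometry n).isClosedEmbedding
    exact this.isClosedMap _ hB
  have hle : prodSub n ≤ B.map (incl n) := by
    refine StarSubalgebra.topologicalClosure_minimal (StarAlgebra.adjoin_le ?_) hcl
    rintro _ ⟨i, rfl⟩
    exact ⟨S i, hS i, rfl⟩
  rw [eq_top_iff]
  rintro x -
  obtain ⟨y, hy, hyx⟩ := hle x.2
  rwa [← incl_injective n hyx]

theorem hom_continuous {A B : Type*} [CStarAlgebra A] [CStarAlgebra B] (f : A →⋆ₐ[ℂ] B) :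
    Continuous f :=
  AddMonoidHomClass.continuous_of_bound f 1
    (fun a => by simpa only [one_mul] using NonUnitalStarAlgHom.norm_apply_le f a)

/-- A star homomorphism on the Cuntz algebra is determined by its values on the generators. -/
theorem hom_ext {n : ℕ} {B : Type*} [CStarAlgebra B] {f g : CuntzAlgebra n →⋆ₐ[ℂ] B}
    (h : ∀ i, f (S i) = g (S i)) : f = g := by
  have := eq_top_of_closed (StarAlgHom.equalizer f g)
    (isClosed_eq (hom_continuous f) (hom_continuous g)) h
  ext x
  exact (this ▸ StarSubalgebra.mem_top : x ∈ StarAlgHom.equalizer f g)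

/-- The universal property: every Cuntz family of `n` isometries in a nonzero unital C*-algebra is
the image of the canonical one under a star homomorphism (unique by `hom_ext`). -/
theorem exists_lift {n : ℕ} {B : Type} [CStarAlgebra B] [Nontrivial B] (T : Fin n → B)
    (hT : IsCuntzFamily T) : ∃ f : CuntzAlgebra n →⋆ₐ[ℂ] B, ∀ i, f (S i) = T i :=
  let ρ : Model n := ⟨B, T, hT⟩
  let ev : Product n →⋆ₐ[ℂ] B :=
    { toFun := fun x => x ρ
      map_one' := rfl
      map_mul' := fun _ _ => rfl
      map_zero' := rfl
      map_add' := fun _ _ => rfl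
      commutes' := fun _ => rfl
      map_star' := fun _ => rfl }
  ⟨ev.comp (incl n), fun _ => rfl⟩

/-! ## The endomorphisms `λ_v` -/

theorem IsCuntzFamily.unitary_mul {n : ℕ} {A : Type*} [CStarAlgebra A] {T : Fin n → A}
    (hT : IsCuntzFamily T) (v : unitary A) : IsCuntzFamily (fun i => (v : A) * T i) where
  isometry i := by
    rw [star_mul, mul_assoc, ← mul_assoc (star (v : A)), Unitary.coe_star_mul_self, one_mul,
      hT.isometry]
  sum_range := by
    have : ∀ i, (v : A) * T i * star ((v : A) * T i) = v * (T i * star (T i)) * star (v : A) := by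
      intro i; simp only [star_mul, mul_assoc]
    simp_rw [this, ← Finset.sum_mul, ← Finset.mul_sum, hT.sum_range, mul_one]
    exact Unitary.mul_star_self_of_mem v.2

/-- The `ρ`-th coordinate of a unitary of the Cuntz algebra. -/
def coord {n : ℕ} (v : unitary (CuntzAlgebra n)) (ρ : Model n) : unitary ρ.carrier :=
  ⟨incl n v ρ, by
    constructor
    · have : star (incl n v) * incl n v = 1 := by
        rw [← map_star, ← map_mul, Unitary.star_mul_self_of_mem v.2, map_one]
      exact congrArg (fun x : Product n => x ρ) this
    · have : incl n v * star (incl n v) = 1 := by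
        rw [← map_star, ← map_mul, Unitary.mul_star_self_of_mem v.2, map_one]
      exact congrArg (fun x : Product n => x ρ) this⟩

/-- The Cuntz family `v S₁, …, v Sₙ` in the coordinate `ρ`. -/
abbrev twist {n : ℕ} (v : unitary (CuntzAlgebra n)) (ρ : Model n) : Model n where
  carrier := ρ.carrier
  gen i := (coord v ρ : ρ.carrier) * ρ.gen i
  isCuntz := ρ.isCuntz.unitary_mul (coord v ρ)

/-- Evaluation of a bounded family at the twisted indices. -/
def twistHom {n : ℕ} (v : unitary (CuntzAlgebra n)) : Product n →⋆ₐ[ℂ] Product n where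
  toFun x := ⟨fun ρ => x (twist v ρ), memℓp_infty ⟨‖x‖, by
    rintro _ ⟨ρ, rfl⟩
    exact lp.norm_apply_le_norm ENNReal.top_ne_zero x (twist v ρ)⟩⟩
  map_one' := rfl
  map_mul' _ _ := rfl
  map_zero' := rfl
  map_add' _ _ := rfl
  commutes' _ := rfl
  map_star' _ := rfl

theorem twistHom_prodGen {n : ℕ} (v : unitary (CuntzAlgebra n)) (i : Fin n) :
    twistHom v (prodGen n i) = incl n ((v : CuntzAlgebra n) * S i) := rfl

theorem twistHom_mem {n : ℕ} (v : unitary (CuntzAlgebra n)) (x : CuntzAlgebra n) :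
    twistHom v (incl n x) ∈ prodSub n := by
  have := eq_top_of_closed ((prodSub n).comap ((twistHom v).comp (incl n)))
    ((StarSubalgebra.isClosed_topologicalClosure _).preimage
      (hom_continuous ((twistHom v).comp (incl n))))
    (fun i => ((v : CuntzAlgebra n) * S i).2)
  exact (this ▸ StarSubalgebra.mem_top :
    x ∈ (prodSub n).comap ((twistHom v).comp (incl n)))

/-- The unital endomorphism `λ_v` of the Cuntz algebra with `λ_v (S i) = v * S i`. -/
def lam {n : ℕ} (v : unitary (CuntzAlgebra n)) : CuntzAlgebra n →⋆ₐ[ℂ] CuntzAlgebra n :=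
  ((twistHom v).comp (incl n)).codRestrict (prodSub n) (twistHom_mem v)

@[simp] theorem lam_S {n : ℕ} (v : unitary (CuntzAlgebra n)) (i : Fin n) :
    lam v (S i) = v * S i := rfl

/-! ## The canonical endomorphism and the core UHF subalgebra -/

/-- The canonical endomorphism (shift) `φ(x) = ∑ i, S i * x * star (S i)`. -/
def shift (n : ℕ) : CuntzAlgebra n →⋆ₐ[ℂ] CuntzAlgebra n where
  toFun x := ∑ i, S i * x * star (S i)
  map_one' := by simpa using (isCuntzFamily_S n).sum_range
  map_mul' x y := by
    rw [Finset.sum_mul_sum]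
    refine Finset.sum_congr rfl fun i _ => ?_
    rw [Finset.sum_eq_single i]
    · rw [show S i * x * star (S i) * (S i * y * star (S i))
          = S i * x * (star (S i) * S i) * y * star (S i) by simp only [mul_assoc],
        (isCuntzFamily_S n).isometry, mul_one, mul_assoc (S i) x y]
    · intro j _ hj
      rw [show S i * x * star (S i) * (S j * y * star (S j))
          = S i * x * (star (S i) * S j) * y * star (S j) by simp only [mul_assoc],
        (isCuntzFamily_S n).star_mul_of_ne (Ne.symm hj)]
      simp
    · simp
  map_zero' := by simp
  map_add' x y := by simp [mul_add, add_mul, Finset.sum_add_distrib]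
  commutes' c := by
    simp_rw [Algebra.algebraMap_eq_smul_one, mul_smul_comm, smul_mul_assoc, mul_one,
      ← Finset.smul_sum, (isCuntzFamily_S n).sum_range]
  map_star' x := by simp [star_sum, mul_assoc]

theorem shift_apply {n : ℕ} (x : CuntzAlgebra n) : shift n x = ∑ i, S i * x * star (S i) := rfl

theorem S_mul {n : ℕ} (i : Fin n) (a : CuntzAlgebra n) : S i * a = shift n a * S i := by
  rw [shift_apply, Finset.sum_mul, Finset.sum_eq_single i]
  · rw [mul_assoc, (isCuntzFamily_S n).isometry, mul_one]
  · intro j _ hj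
    rw [mul_assoc, (isCuntzFamily_S n).star_mul_of_ne hj, mul_zero]
  · simp

/-- The word `S μ₁ ⋯ S μₖ` of a multi-index. -/
def word {n : ℕ} (μ : List (Fin n)) : CuntzAlgebra n := (μ.map S).prod

@[simp] theorem word_nil {n : ℕ} : word ([] : List (Fin n)) = 1 := rfl

@[simp] theorem word_cons {n : ℕ} (i : Fin n) (μ : List (Fin n)) :
    word (i :: μ) = S i * word μ := by simp [word]

theorem word_append {n : ℕ} (μ ν : List (Fin n)) : word (μ ++ ν) = word μ * word ν := by
  simp [word]

theorem word_mul {n : ℕ} (μ : List (Fin n)) (a : CuntzAlgebra n) :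
    word μ * a = (shift n)^[μ.length] a * word μ := by
  induction μ generalizing a with
  | nil => simp
  | cons i μ ih =>
    rw [word_cons, mul_assoc, ih, ← mul_assoc, S_mul, mul_assoc, List.length_cons,
      Function.iterate_succ_apply']

theorem star_word_mul_word {n : ℕ} (μ ν : List (Fin n)) (h : μ.length = ν.length) :
    star (word μ) * word ν = if μ = ν then 1 else 0 := by
  induction μ generalizing ν with
  | nil =>
    obtain rfl : ν = [] := List.length_eq_zero_iff.1 h.symm
    simp
  | cons i μ ih =>
    cases ν with
    | nil => simp at h
    | cons j ν =>
      have h' : μ.length = ν.length := by simpa using h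
      rw [word_cons, word_cons, star_mul, show star (word μ) * star (S i) * (S j * word ν)
        = star (word μ) * (star (S i) * S j) * word ν by simp only [mul_assoc]]
      by_cases hij : i = j
      · subst hij
        rw [(isCuntzFamily_S n).isometry, mul_one, ih ν h']
        simp
      · rw [(isCuntzFamily_S n).star_mul_of_ne hij]
        simp [hij]

/-- The linear span of the elements `S_μ S_ν*` with `μ` and `ν` of length `k`. -/
def coreSpan (n k : ℕ) : Submodule ℂ (CuntzAlgebra n) :=
  Submodule.span ℂ {x | ∃ μ ν : List (Fin n), μ.length = k ∧ ν.length = k ∧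
    x = word μ * star (word ν)}

theorem mem_coreSpan {n : ℕ} {μ ν : List (Fin n)} (h : μ.length = ν.length) :
    word μ * star (word ν) ∈ coreSpan n ν.length :=
  Submodule.subset_span ⟨μ, ν, h, rfl, rfl⟩

theorem coreSpan_le_succ (n k : ℕ) : coreSpan n k ≤ coreSpan n (k + 1) := by
  refine Submodule.span_le.2 ?_
  rintro _ ⟨μ, ν, hμ, hν, rfl⟩
  have : word μ * star (word ν) = ∑ i, word (μ ++ [i]) * star (word (ν ++ [i])) := by
    have h : ∀ i, word (μ ++ [i]) * star (word (ν ++ [i]))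
        = word μ * (S i * star (S i)) * star (word ν) := by
      intro i; simp [word_append, mul_assoc]
    simp_rw [h, ← Finset.sum_mul, ← Finset.mul_sum, (isCuntzFamily_S n).sum_range, mul_one]
  rw [this]
  exact Submodule.sum_mem _ fun i _ => Submodule.subset_span
    ⟨_, _, by simp [hμ], by simp [hν], rfl⟩

theorem one_mem_coreSpan (n k : ℕ) : 1 ∈ coreSpan n k := by
  induction k with
  | zero => exact Submodule.subset_span ⟨[], [], rfl, rfl, by simp⟩
  | succ k ih => exact coreSpan_le_succ n k ih

theorem mul_mem_coreSpan {n k : ℕ} {x y : CuntzAlgebra n} (hx : x ∈ coreSpan n k)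
    (hy : y ∈ coreSpan n k) : x * y ∈ coreSpan n k := by
  have h : coreSpan n k * coreSpan n k ≤ coreSpan n k := by
    rw [coreSpan, Submodule.span_mul_span, Submodule.span_le]
    rintro _ ⟨_, ⟨μ, ν, hμ, hν, rfl⟩, _, ⟨μ', ν', hμ', hν', rfl⟩, rfl⟩
    have e : word μ * star (word ν) * (word μ' * star (word ν'))
        = word μ * (star (word ν) * word μ') * star (word ν') := by simp only [mul_assoc]
    simp only [SetLike.mem_coe]
    rw [e, star_word_mul_word _ _ (hν.trans hμ'.symm)]
    split_ifs
    · rw [mul_one]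
      exact Submodule.subset_span ⟨μ, ν', hμ, hν', rfl⟩
    · simp
  exact h (Submodule.mul_mem_mul hx hy)

theorem star_mem_coreSpan {n k : ℕ} {x : CuntzAlgebra n} (hx : x ∈ coreSpan n k) :
    star x ∈ coreSpan n k := by
  induction hx using Submodule.span_induction with
  | mem x hx =>
    obtain ⟨μ, ν, hμ, hν, rfl⟩ := hx
    exact Submodule.subset_span ⟨ν, μ, hν, hμ, by simp⟩
  | zero => simp
  | add x y _ _ hx hy => rw [star_add]; exact add_mem hx hy
  | smul c x _ hx => rw [star_smul]; exact Submodule.smul_mem _ _ hx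

/-- The matrix subalgebra `𝓕ₙᵏ ≅ Mₙ ⊗ ⋯ ⊗ Mₙ` (`k` factors), the linear span of the elements
`S_μ S_ν*` with `μ` and `ν` of length `k`. -/
def coreLevel (n k : ℕ) : StarSubalgebra ℂ (CuntzAlgebra n) where
  carrier := coreSpan n k
  mul_mem' := mul_mem_coreSpan
  add_mem' := add_mem
  algebraMap_mem' c := by
    rw [Algebra.algebraMap_eq_smul_one]
    exact Submodule.smul_mem _ _ (one_mem_coreSpan n k)
  star_mem' := star_mem_coreSpan

theorem coreLevel_mono (n : ℕ) : Monotone (coreLevel n) :=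
  monotone_nat_of_le_succ fun k => coreSpan_le_succ n k

/-- The core UHF subalgebra `𝓕ₙ`, the norm closure of the union of the `𝓕ₙᵏ`. -/
def core (n : ℕ) : StarSubalgebra ℂ (CuntzAlgebra n) :=
  (⨆ k, coreLevel n k).topologicalClosure

theorem coe_core (n : ℕ) :
    (core n : Set (CuntzAlgebra n)) = closure (⋃ k, (coreLevel n k : Set (CuntzAlgebra n))) := by
  rw [core, StarSubalgebra.topologicalClosure_coe,
    StarSubalgebra.coe_iSup_of_directed (coreLevel_mono n).directed_le]

theorem isClosed_core (n : ℕ) : IsClosed (core n : Set (CuntzAlgebra n)) :=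
  StarSubalgebra.isClosed_topologicalClosure _

theorem coreLevel_le_core (n k : ℕ) : coreLevel n k ≤ core n :=
  (le_iSup (coreLevel n) k).trans (StarSubalgebra.le_topologicalClosure _)

theorem shift_mem_coreLevel {n k : ℕ} {x : CuntzAlgebra n} (hx : x ∈ coreLevel n k) :
    shift n x ∈ coreLevel n (k + 1) := by
  have h : coreSpan n k ≤ (coreSpan n (k + 1)).comap (shift n).toLinearMap := by
    refine Submodule.span_le.2 ?_
    rintro _ ⟨μ, ν, hμ, hν, rfl⟩
    change shift n (word μ * star (word ν)) ∈ coreSpan n (k + 1)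
    rw [shift_apply]
    exact Submodule.sum_mem _ fun i _ => Submodule.subset_span
      ⟨i :: μ, i :: ν, by simp [hμ], by simp [hν], by simp [mul_assoc]⟩
  exact h hx

theorem iterate_shift_mem_coreLevel {n k : ℕ} {x : CuntzAlgebra n} (hx : x ∈ coreLevel n k)
    (j : ℕ) : (shift n)^[j] x ∈ coreLevel n (k + j) := by
  induction j with
  | zero => exact hx
  | succ j ih => rw [Function.iterate_succ_apply']; exact shift_mem_coreLevel ih

theorem iterate_shift_star {n : ℕ} (j : ℕ) (a : CuntzAlgebra n) :
    (shift n)^[j] (star a) = star ((shift n)^[j] a) := by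
  induction j with
  | zero => rfl
  | succ j ih => rw [Function.iterate_succ_apply', Function.iterate_succ_apply', ih, map_star]

theorem iterate_shift_mem_unitary {n : ℕ} {a : CuntzAlgebra n}
    (ha : a ∈ unitary (CuntzAlgebra n)) (j : ℕ) :
    (shift n)^[j] a ∈ unitary (CuntzAlgebra n) := by
  induction j with
  | zero => exact ha
  | succ j ih => rw [Function.iterate_succ_apply']; exact Unitary.map_mem (shift n) ih

/-- `φᵏ(a)` commutes with `𝓕ₙᵏ`. -/
theorem commute_iterate_shift {n k : ℕ} {x : CuntzAlgebra n} (hx : x ∈ coreLevel n k)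
    (a : CuntzAlgebra n) : Commute ((shift n)^[k] a) x := by
  change x ∈ coreSpan n k at hx
  induction hx using Submodule.span_induction with
  | mem x hx =>
    obtain ⟨μ, ν, rfl, hν, rfl⟩ := hx
    have h1 := word_mul μ a
    have h2 := congrArg star (word_mul ν (star a))
    rw [iterate_shift_star, star_mul, star_mul, star_star, star_star, hν] at h2
    rw [Commute, SemiconjBy, ← mul_assoc, ← h1, mul_assoc, mul_assoc, h2]
  | zero => exact Commute.zero_right _
  | add x y _ _ hx hy => exact hx.add_right hy
  | smul c x _ hx => exact hx.smul_right c

/-! ## Tensor products and product-type automorphisms -/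

/-- `tensor a k = a₀ ⊗ a₁ ⊗ ⋯ ⊗ aₖ₋₁ ⊗ 1 ⊗ 1 ⊗ ⋯` for `aⱼ` in `𝓕ₙ¹ ≅ Mₙ`: in the identification of
`𝓕ₙ` with `⨂ Mₙ` the factor number `j` (counted from `0`) is `φʲ(𝓕ₙ¹)`. -/
def tensor {n : ℕ} (a : ℕ → CuntzAlgebra n) : ℕ → CuntzAlgebra n
  | 0 => 1
  | k + 1 => tensor a k * (shift n)^[k] (a k)

theorem tensor_mem_coreLevel {n : ℕ} {a : ℕ → CuntzAlgebra n} (ha : ∀ k, a k ∈ coreLevel n 1)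
    (k : ℕ) : tensor a k ∈ coreLevel n k := by
  induction k with
  | zero => exact one_mem _
  | succ k ih =>
    refine mul_mem (coreLevel_mono n (Nat.le_succ k) ih) ?_
    rw [add_comm]
    exact iterate_shift_mem_coreLevel (ha k) k

theorem tensor_mem_unitary {n : ℕ} {a : ℕ → CuntzAlgebra n}
    (ha : ∀ k, a k ∈ unitary (CuntzAlgebra n)) (k : ℕ) :
    tensor a k ∈ unitary (CuntzAlgebra n) := by
  induction k with
  | zero => exact one_mem _
  | succ k ih => exact mul_mem ih (iterate_shift_mem_unitary (ha k) k)

/-- The underlying sequence in the Cuntz algebra of a sequence of unitaries of `𝓕ₙ¹`. -/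
abbrev seq {n : ℕ} (u : ℕ → unitary (coreLevel n 1)) (k : ℕ) : CuntzAlgebra n :=
  ((u k : coreLevel n 1) : CuntzAlgebra n)

theorem seq_mem_unitary {n : ℕ} (u : ℕ → unitary (coreLevel n 1)) (k : ℕ) :
    seq u k ∈ unitary (CuntzAlgebra n) :=
  Unitary.map_mem (coreLevel n 1).subtype (u k).2

/-- A sequence of unitaries whose conjugations become stationary on each `𝓕ₙᵏ` converges
pointwise on `𝓕ₙ`. -/
theorem exists_tendsto_conj {n : ℕ} {W : ℕ → CuntzAlgebra n}
    (hW : ∀ k, W k ∈ unitary (CuntzAlgebra n))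
    (hst : ∀ j, ∀ x ∈ coreLevel n j, ∀ k, j ≤ k → W k * x * star (W k) = W j * x * star (W j))
    {x : CuntzAlgebra n} (hx : x ∈ core n) :
    ∃ y, Tendsto (fun k => W k * x * star (W k)) atTop (𝓝 y) := by
  refine cauchySeq_tendsto_of_complete (Metric.cauchySeq_iff'.2 fun ε hε => ?_)
  have hx' : x ∈ closure (⋃ k, (coreLevel n k : Set (CuntzAlgebra n))) := by
    rw [← coe_core]; exact hx
  obtain ⟨z, hz, hzx⟩ := Metric.mem_closure_iff.1 hx' (ε / 2) (half_pos hε)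
  obtain ⟨j, hj⟩ := Set.mem_iUnion.1 hz
  have key : ∀ k, dist (W k * x * star (W k)) (W k * z * star (W k)) = dist x z := by
    intro k
    rw [dist_eq_norm, dist_eq_norm, ← sub_mul, ← mul_sub,
      CStarRing.norm_mul_mem_unitary _ (Unitary.star_mem (hW k)),
      CStarRing.norm_mem_unitary_mul _ (hW k)]
  refine ⟨j, fun k hk => ?_⟩
  calc dist (W k * x * star (W k)) (W j * x * star (W j))
      ≤ dist (W k * x * star (W k)) (W k * z * star (W k))
        + dist (W k * z * star (W k)) (W j * x * star (W j)) := dist_triangle _ _ _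
    _ = dist x z + dist x z := by
        rw [key, hst j z hj k hk, dist_comm (W j * z * star (W j)), key]
    _ < ε := by linarith

/-- The pointwise limit `x ↦ lim W k * x * star (W k)` on `𝓕ₙ`, for unitaries `W k` of `𝓕ₙ`. -/
def limConj {n : ℕ} (W : ℕ → CuntzAlgebra n) (hW : ∀ k, W k ∈ unitary (CuntzAlgebra n))
    (hc : ∀ k, W k ∈ core n)
    (hlim : ∀ x ∈ core n, ∃ y, Tendsto (fun k => W k * x * star (W k)) atTop (𝓝 y)) :
    core n →⋆ₐ[ℂ] core n where
  toFun x := ⟨(hlim x x.2).choose, (isClosed_core n).mem_of_tendsto (hlim x x.2).choose_spec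
    (Eventually.of_forall fun k => mul_mem (mul_mem (hc k) x.2) (star_mem (hc k)))⟩
  map_one' := by
    refine Subtype.ext (tendsto_nhds_unique (hlim _ (1 : core n).2).choose_spec ?_)
    refine tendsto_const_nhds.congr fun k => ?_
    simp [Unitary.mul_star_self_of_mem (hW k)]
  map_mul' x y := by
    refine Subtype.ext (tendsto_nhds_unique (hlim _ (x * y).2).choose_spec ?_)
    refine ((hlim x x.2).choose_spec.mul (hlim y y.2).choose_spec).congr fun k => ?_
    rw [show W k * (x : CuntzAlgebra n) * star (W k) * (W k * (y : CuntzAlgebra n) * star (W k))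
      = W k * x * (star (W k) * W k) * y * star (W k) by simp only [mul_assoc],
      Unitary.star_mul_self_of_mem (hW k)]
    simp [mul_assoc]
  map_zero' := by
    refine Subtype.ext (tendsto_nhds_unique (hlim _ (0 : core n).2).choose_spec ?_)
    refine tendsto_const_nhds.congr fun k => ?_
    simp
  map_add' x y := by
    refine Subtype.ext (tendsto_nhds_unique (hlim _ (x + y).2).choose_spec ?_)
    refine ((hlim x x.2).choose_spec.add (hlim y y.2).choose_spec).congr fun k => ?_
    simp [mul_add, add_mul]
  commutes' c := by
    refine Subtype.ext (tendsto_nhds_unique (hlim _ (algebraMap ℂ (core n) c).2).choose_spec ?_)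
    refine tendsto_const_nhds.congr fun k => ?_
    simp [Algebra.algebraMap_eq_smul_one, Unitary.mul_star_self_of_mem (hW k)]
  map_star' x := by
    refine Subtype.ext (tendsto_nhds_unique (hlim _ (star x).2).choose_spec ?_)
    refine ((hlim x x.2).choose_spec.star).congr fun k => ?_
    simp [mul_assoc]

theorem tendsto_limConj {n : ℕ} {W : ℕ → CuntzAlgebra n}
    (hW : ∀ k, W k ∈ unitary (CuntzAlgebra n)) (hc : ∀ k, W k ∈ core n)
    (hlim : ∀ x ∈ core n, ∃ y, Tendsto (fun k => W k * x * star (W k)) atTop (𝓝 y))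
    (x : core n) :
    Tendsto (fun k => W k * (x : CuntzAlgebra n) * star (W k)) atTop
      (𝓝 (limConj W hW hc hlim x : CuntzAlgebra n)) :=
  (hlim x x.2).choose_spec

theorem limConj_limConj {n : ℕ} {W V : ℕ → CuntzAlgebra n}
    (hW : ∀ k, W k ∈ unitary (CuntzAlgebra n)) (hc : ∀ k, W k ∈ core n)
    (hlim : ∀ x ∈ core n, ∃ y, Tendsto (fun k => W k * x * star (W k)) atTop (𝓝 y))
    (hW' : ∀ k, V k ∈ unitary (CuntzAlgebra n)) (hc' : ∀ k, V k ∈ core n)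
    (hlim' : ∀ x ∈ core n, ∃ y, Tendsto (fun k => V k * x * star (V k)) atTop (𝓝 y))
    (h : ∀ k, V k = star (W k)) (x : core n) :
    limConj V hW' hc' hlim' (limConj W hW hc hlim x) = x := by
  refine Subtype.ext (tendsto_nhds_unique (tendsto_limConj hW' hc' hlim' _) ?_)
  rw [tendsto_iff_norm_sub_tendsto_zero]
  have h1 := tendsto_iff_norm_sub_tendsto_zero.1 (tendsto_limConj hW hc hlim x)
  refine h1.congr fun k => ?_
  have e : V k * (limConj W hW hc hlim x : CuntzAlgebra n) * star (V k) - x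
      = star (W k) * ((limConj W hW hc hlim x : CuntzAlgebra n)
        - W k * (x : CuntzAlgebra n) * star (W k)) * W k := by
    rw [h, star_star, mul_sub, sub_mul,
      show star (W k) * (W k * (x : CuntzAlgebra n) * star (W k)) * W k
        = (star (W k) * W k) * x * (star (W k) * W k) by simp only [mul_assoc],
      Unitary.star_mul_self_of_mem (hW k), one_mul, mul_one]
  rw [e, CStarRing.norm_mul_mem_unitary _ (hW k),
    CStarRing.norm_mem_unitary_mul _ (Unitary.star_mem (hW k)), norm_sub_rev]

section ProductType

variable {n : ℕ} (u : ℕ → unitary (coreLevel n 1))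

theorem tensor_seq_mem_unitary (k : ℕ) : tensor (seq u) k ∈ unitary (CuntzAlgebra n) :=
  tensor_mem_unitary (seq_mem_unitary u) k

theorem tensor_seq_mem_coreLevel (k : ℕ) : tensor (seq u) k ∈ coreLevel n k :=
  tensor_mem_coreLevel (fun k => (u k : coreLevel n 1).2) k

theorem conj_tensor_stationary (j : ℕ) (x : CuntzAlgebra n) (hx : x ∈ coreLevel n j) (k : ℕ)
    (hk : j ≤ k) : tensor (seq u) k * x * star (tensor (seq u) k)
      = tensor (seq u) j * x * star (tensor (seq u) j) := by
  induction k, hk using Nat.le_induction with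
  | base => rfl
  | succ k hk ih =>
    have hcomm := commute_iterate_shift (coreLevel_mono n hk hx) (seq u k)
    have hun := iterate_shift_mem_unitary (seq_mem_unitary u k) k
    rw [← ih, tensor, star_mul, mul_assoc (tensor (seq u) k), hcomm.eq]
    calc _ = tensor (seq u) k * x * ((shift n)^[k] (seq u k) * star ((shift n)^[k] (seq u k)))
          * star (tensor (seq u) k) := by simp only [mul_assoc]
      _ = _ := by rw [Unitary.mul_star_self_of_mem hun, mul_one]

theorem conj_star_tensor_stationary (j : ℕ) (x : CuntzAlgebra n) (hx : x ∈ coreLevel n j)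
    (k : ℕ) (hk : j ≤ k) : star (tensor (seq u) k) * x * star (star (tensor (seq u) k))
      = star (tensor (seq u) j) * x * star (star (tensor (seq u) j)) := by
  induction k, hk using Nat.le_induction with
  | base => rfl
  | succ k hk ih =>
    have hm := tensor_seq_mem_coreLevel u k
    have hcomm := commute_iterate_shift
      (mul_mem (mul_mem (star_mem hm) (coreLevel_mono n hk hx)) hm) (seq u k)
    have hun := iterate_shift_mem_unitary (seq_mem_unitary u k) k
    rw [← ih, tensor, star_star, star_star, star_mul]
    calc _ = star ((shift n)^[k] (seq u k)) * (star (tensor (seq u) k) * x * tensor (seq u) k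
          * (shift n)^[k] (seq u k)) := by simp only [mul_assoc]
      _ = _ := by rw [← hcomm.eq, ← mul_assoc, Unitary.star_mul_self_of_mem hun, one_mul]

theorem tensor_seq_mem_core (k : ℕ) : tensor (seq u) k ∈ core n :=
  coreLevel_le_core n k (tensor_seq_mem_coreLevel u k)

theorem exists_tendsto_tensor (x : CuntzAlgebra n) (hx : x ∈ core n) :
    ∃ y, Tendsto (fun k => tensor (seq u) k * x * star (tensor (seq u) k)) atTop (𝓝 y) :=
  exists_tendsto_conj (tensor_seq_mem_unitary u) (conj_tensor_stationary u) hx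

theorem exists_tendsto_star_tensor (x : CuntzAlgebra n) (hx : x ∈ core n) :
    ∃ y, Tendsto (fun k => star (tensor (seq u) k) * x * star (star (tensor (seq u) k)))
      atTop (𝓝 y) :=
  exists_tendsto_conj (W := fun k => star (tensor (seq u) k))
    (fun k => Unitary.star_mem (tensor_seq_mem_unitary u k)) (conj_star_tensor_stationary u) hx

/-- The endomorphism `x ↦ lim (u₁ ⊗ ⋯ ⊗ uₖ) x (u₁ ⊗ ⋯ ⊗ uₖ)*` of `𝓕ₙ`. -/
def productHom : core n →⋆ₐ[ℂ] core n :=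
  limConj (tensor (seq u)) (tensor_seq_mem_unitary u) (tensor_seq_mem_core u)
    (exists_tendsto_tensor u)

/-- The endomorphism `x ↦ lim (u₁ ⊗ ⋯ ⊗ uₖ)* x (u₁ ⊗ ⋯ ⊗ uₖ)` of `𝓕ₙ`, inverse to `productHom`. -/
def productInv : core n →⋆ₐ[ℂ] core n :=
  limConj (fun k => star (tensor (seq u) k))
    (fun k => Unitary.star_mem (tensor_seq_mem_unitary u k))
    (fun k => star_mem (tensor_seq_mem_core u k)) (exists_tendsto_star_tensor u)

theorem productInv_productHom (x : core n) : productInv u (productHom u x) = x :=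
  limConj_limConj (tensor_seq_mem_unitary u) (tensor_seq_mem_core u) (exists_tendsto_tensor u)
    (fun k => Unitary.star_mem (tensor_seq_mem_unitary u k))
    (fun k => star_mem (tensor_seq_mem_core u k)) (exists_tendsto_star_tensor u)
    (fun _ => rfl) x

theorem productHom_productInv (x : core n) : productHom u (productInv u x) = x :=
  limConj_limConj (fun k => Unitary.star_mem (tensor_seq_mem_unitary u k))
    (fun k => star_mem (tensor_seq_mem_core u k)) (exists_tendsto_star_tensor u)
    (tensor_seq_mem_unitary u) (tensor_seq_mem_core u) (exists_tendsto_tensor u)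
    (fun _ => (star_star _).symm) x

/-- The product-type automorphism `α_u = ⨂ᵢ Ad(uᵢ)` of `𝓕ₙ`, the pointwise limit of the inner
automorphisms `Ad(u₁ ⊗ ⋯ ⊗ uₖ)`. -/
def productAut : core n ≃⋆ₐ[ℂ] core n :=
  StarAlgEquiv.ofStarAlgHom (productHom u) (productInv u)
    (StarAlgHom.ext fun x => productInv_productHom u x)
    (StarAlgHom.ext fun x => productHom_productInv u x)

theorem tendsto_productAut (x : core n) :
    Tendsto (fun k => tensor (seq u) k * (x : CuntzAlgebra n) * star (tensor (seq u) k)) atTop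
      (𝓝 (productAut u x : CuntzAlgebra n)) :=
  tendsto_limConj (tensor_seq_mem_unitary u) (tensor_seq_mem_core u) (exists_tendsto_tensor u) x

/-- On `𝓕ₙᵏ` the automorphism `α_u` is `Ad(u₁ ⊗ ⋯ ⊗ uₖ)`. -/
theorem productAut_apply (k : ℕ) (x : core n) (hx : (x : CuntzAlgebra n) ∈ coreLevel n k) :
    (productAut u x : CuntzAlgebra n)
      = tensor (seq u) k * (x : CuntzAlgebra n) * star (tensor (seq u) k) :=
  tendsto_nhds_unique (tendsto_productAut u x) (tendsto_const_nhds.congr'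
    (eventually_atTop.2 ⟨k, fun m hm => (conj_tensor_stationary u k x hx m hm).symm⟩))

/-- `twisted u k μ` is `u_{k+1} S_{μ₁} u_{k+2} S_{μ₂} ⋯`, with `u_{j+1}` written `u j`. -/
def twisted : ℕ → List (Fin n) → CuntzAlgebra n
  | _, [] => 1
  | k, i :: μ => seq u k * S i * twisted (k + 1) μ

theorem twisted_append (k : ℕ) (μ : List (Fin n)) (i : Fin n) :
    twisted u k (μ ++ [i]) = twisted u k μ * (seq u (k + μ.length) * S i) := by
  induction μ generalizing k with
  | nil => simp [twisted]
  | cons j μ ih =>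
    simp only [List.cons_append, twisted, ih, List.length_cons, mul_assoc]
    rw [show k + 1 + μ.length = k + (μ.length + 1) by omega]

theorem tensor_mul_word (μ : List (Fin n)) :
    tensor (seq u) μ.length * word μ = twisted u 0 μ := by
  induction μ using List.reverseRecOn with
  | nil => simp [tensor, twisted]
  | append_singleton μ i ih =>
    rw [twisted_append, ← ih, word_append, List.length_append, List.length_singleton, tensor,
      zero_add, mul_assoc, ← mul_assoc _ (word μ), ← word_mul]
    simp [mul_assoc]

/-- `α_u(S_μ S_ν*) = u₁ S_{μ₁} ⋯ uₖ S_{μₖ} S_{νₖ}* uₖ* ⋯ S_{ν₁}* u₁*`. -/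
theorem productAut_word (x : core n) (μ ν : List (Fin n)) (h : μ.length = ν.length)
    (hx : (x : CuntzAlgebra n) = word μ * star (word ν)) :
    (productAut u x : CuntzAlgebra n) = twisted u 0 μ * star (twisted u 0 ν) := by
  rw [productAut_apply u ν.length x (hx ▸ mem_coreSpan h), hx, ← tensor_mul_word,
    ← tensor_mul_word, star_mul, h]
  simp only [mul_assoc]

end ProductType

/-- The sequence `a₁, a₂ a₁*, a₃ a₂*, …` of successive quotients. -/
def quot {n : ℕ} (a : ℕ → CuntzAlgebra n) : ℕ → CuntzAlgebra n
  | 0 => a 0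
  | k + 1 => a (k + 1) * star (a k)

/-! ## The restriction map -/

/-- `Aut(𝒪ₙ, 𝓕ₙ)`: the automorphisms of `𝒪ₙ` leaving `𝓕ₙ` globally invariant. -/
def autCore (n : ℕ) : Subgroup (CuntzAlgebra n ≃⋆ₐ[ℂ] CuntzAlgebra n) where
  carrier := {e | ∀ x, e x ∈ core n ↔ x ∈ core n}
  one_mem' _ := Iff.rfl
  mul_mem' {e f} he hf x := (he (f x)).trans (hf x)
  inv_mem' {e} he x := by
    rw [← he (e⁻¹ x), ← StarAlgEquiv.mul_apply, mul_inv_cancel, StarAlgEquiv.one_apply]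

/-- The restriction map `r : Aut(𝒪ₙ, 𝓕ₙ) → Aut(𝓕ₙ)`. -/
def restrict (n : ℕ) : autCore n →* (core n ≃⋆ₐ[ℂ] core n) where
  toFun e :=
    { toFun := fun x => ⟨e.1 x, (e.2 x).2 x.2⟩
      invFun := fun x => ⟨(e⁻¹).1 x, ((e⁻¹).2 x).2 x.2⟩
      left_inv := fun x => Subtype.ext (e.1.symm_apply_apply x)
      right_inv := fun x => Subtype.ext (e.1.apply_symm_apply x)
      map_mul' := fun _ _ => Subtype.ext (map_mul e.1 _ _)
      map_add' := fun _ _ => Subtype.ext (map_add e.1 _ _)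
      map_star' := fun _ => Subtype.ext (map_star e.1 _)
      map_smul' := fun c _ => Subtype.ext (map_smul e.1 c _) }
  map_one' := rfl
  map_mul' _ _ := rfl

end

end Cuntz

open Cuntz

namespace Cuntz

noncomputable section

variable {n : ℕ}

/-! Write W_k = u₁ ⊗ ⋯ ⊗ u_k and Q_k for the k-th term of the sequence whose limit is in question.
Everything rests on Q_{k+1} = W_{k+1} φ(W_k)*, which by φ(x) Sᵢ = Sᵢ x gives Q_{k+1} Sᵢ = W_{k+1} Sᵢ
W_k*.

(a) If Q_k → v, these products telescope to λ_v(S_μ) = lim W_{k+|μ|} S_μ W_k*, so λ_v agrees with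
α_u on every S_μ S_ν* with |μ| = |ν|. The sequence u* has quotient tensors W_{k+1}* Q_{k+1}*
W_{k+1}, which converge to w = α_u⁻¹(v*). Then λ_v(w) = v* and λ_w(v) = w*, which makes λ_v and λ_w
mutually inverse.

(b) An extension ρ of α_u is λ_v for v = ∑ ρ(Sᵢ) Sᵢ*. On 𝓕ₙᵏ both Ad(v) and Ad(Q_k) act alike, so
Q_k* v commutes with 𝓕ₙᵏ and equals φᵏ(y_k) for some y_k (`exists_iterate_shift_eq`). The heart is
that y_k is nearly scalar (`exists_norm_sub_smul_tensor_le`). Compress v between product vectors T =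
t₁ ⋯ t_k and R = Q_k T made of isometries in the span of the generators: R* v T = y_k. Approximate v
by a combination p of words S_α S_β*. A word with |α| = |β| compresses to a scalar; one with |α| ≠
|β| shifts R against T, and a single marked position, where R is orthogonal to all other factors of
T, annihilates it. So R* p T is scalar and v is close to a multiple of Q_k. Phases of the u_k
telescope to one phase on Q_k, so they can be chosen to give convergence.

(c) Take u_k to be powers of a symmetry w ≠ ±1. Whatever the phases, the successive quotients are
multiples of w, which stay at distance at least 1 from the identity, whereas convergence would force
them to 1. By (b), α_u does not extend. -/

/-! ### Tensor products of successive quotients -/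

theorem seq_mem_coreLevel (u : ℕ → unitary (coreLevel n 1)) (k : ℕ) :
    seq u k ∈ coreLevel n 1 := (u k : coreLevel n 1).2

theorem quot_mem_coreLevel {a : ℕ → CuntzAlgebra n} (ha : ∀ k, a k ∈ coreLevel n 1) :
    ∀ k, quot a k ∈ coreLevel n 1
  | 0 => ha 0
  | k + 1 => mul_mem (ha (k + 1)) (star_mem (ha k))

theorem quot_mem_unitary {a : ℕ → CuntzAlgebra n} (ha : ∀ k, a k ∈ unitary (CuntzAlgebra n)) :
    ∀ k, quot a k ∈ unitary (CuntzAlgebra n)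
  | 0 => ha 0
  | k + 1 => mul_mem (ha (k + 1)) (Unitary.star_mem (ha k))

/-- `a₁ ⊗ a₂ a₁* ⊗ ⋯ ⊗ aₖ₊₁ aₖ* = (a₁ ⊗ ⋯ ⊗ aₖ₊₁) φ(a₁ ⊗ ⋯ ⊗ aₖ)*`. -/
theorem tensor_quot_succ {a : ℕ → CuntzAlgebra n} (ha : ∀ k, a k ∈ coreLevel n 1) (k : ℕ) :
    tensor (quot a) (k + 1) = tensor a (k + 1) * star (shift n (tensor a k)) := by
  induction k with
  | zero => simp [tensor, quot]
  | succ k ih =>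
    have h1 : star (shift n (tensor a k)) ∈ coreLevel n (k + 1) :=
      star_mem (shift_mem_coreLevel (tensor_mem_coreLevel ha k))
    have hc := (commute_iterate_shift h1 (a (k + 1) * star (a k))).eq
    have hm : ∀ (j : ℕ) (x y : CuntzAlgebra n),
        (shift n)^[j] (x * y) = (shift n)^[j] x * (shift n)^[j] y := fun j x y =>
      iterate_map_mul (shift n) j x y
    -- The new factor φᵏ⁺¹(a_{k+1} a_k*) commutes with the trailing factor in φ(𝓕ₙᵏ) ⊆ 𝓕ₙᵏ⁺¹; moved
    -- in front of it, its two halves join the two tensors separately.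
    rw [tensor, ih, quot, mul_assoc, ← hc, tensor.eq_2 a (k + 1), tensor.eq_2 a k, map_mul,
      star_mul, hm, iterate_shift_star, ← Function.iterate_succ_apply' (shift n) k]
    simp only [mul_assoc]

/-- Taking adjoints reverses the factors φʲ(aⱼ), but they commute with each other. -/
theorem tensor_star {a : ℕ → CuntzAlgebra n} (ha : ∀ k, a k ∈ coreLevel n 1) (k : ℕ) :
    tensor (fun j => star (a j)) k = star (tensor a k) := by
  induction k with
  | zero => simp [tensor]
  | succ k ih =>
    rw [tensor, ih, tensor, star_mul, ← iterate_shift_star]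
    exact (commute_iterate_shift (star_mem (tensor_mem_coreLevel ha k)) _).eq.symm

/-! ### Convergence of the quotient tensors gives an automorphism extending α_u -/

theorem tensor_quot_succ_mul_S {a : ℕ → CuntzAlgebra n} (ha : ∀ k, a k ∈ coreLevel n 1) (k : ℕ)
    (i : Fin n) :
    tensor (quot a) (k + 1) * S i = tensor a (k + 1) * S i * star (tensor a k) := by
  rw [tensor_quot_succ ha, mul_assoc, mul_assoc, S_mul, map_star]

/-- Telescoping: each letter Sᵢ contributes W_{m+1} Sᵢ W_m*, and the inner unitaries of neighbouring
letters cancel. -/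
theorem tendsto_lam_word {a : ℕ → CuntzAlgebra n} (ha : ∀ k, a k ∈ coreLevel n 1)
    (hu : ∀ k, a k ∈ unitary (CuntzAlgebra n)) {v : unitary (CuntzAlgebra n)}
    (hv : Tendsto (tensor (quot a)) atTop (𝓝 (v : CuntzAlgebra n))) (μ : List (Fin n)) :
    Tendsto (fun k => tensor a (k + μ.length) * word μ * star (tensor a k)) atTop
      (𝓝 (lam v (word μ))) := by
  induction μ with
  | nil =>
    simp only [List.length_nil, add_zero, word_nil, mul_one, map_one]
    exact tendsto_const_nhds.congr fun k =>
      (Unitary.mul_star_self_of_mem (tensor_mem_unitary hu k)).symm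
  | cons i μ ih =>
    rw [word_cons, map_mul, lam_S]
    -- The index is advanced by |μ| + 1 so that the right-hand W* of the letter i meets the
    -- left-hand W of the word μ.
    have h1 : Tendsto (fun k => tensor (quot a) (k + (μ.length + 1))) atTop
      (𝓝 (v : CuntzAlgebra n)) := hv.comp (tendsto_add_atTop_nat _)
    refine ((h1.mul_const (S i)).mul ih).congr fun k => ?_
    rw [← add_assoc, tensor_quot_succ_mul_S ha,
      show ∀ w x y z s : CuntzAlgebra n, w * x * star y * (y * z * s)
        = w * x * (star y * y) * z * s from fun w x y z s => by simp only [mul_assoc],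
      Unitary.star_mul_self_of_mem (tensor_mem_unitary hu _), mul_one, List.length_cons,
      ← add_assoc, mul_assoc (tensor a _) (S i)]

/-- Makes 𝓕ₙ a C*-algebra, so that star homomorphisms on it are continuous. -/
instance (n : ℕ) : IsClosed (core n : Set (CuntzAlgebra n)) := isClosed_core n

/-- Star homomorphisms on `𝓕ₙ` are determined by their values on the elements `S_μ S_ν*`. -/
theorem core_hom_ext {B : Type*} [CStarAlgebra B] {f g : core n →⋆ₐ[ℂ] B}
    (h : ∀ (x : core n) (μ ν : List (Fin n)), μ.length = ν.length →
      (x : CuntzAlgebra n) = word μ * star (word ν) → f x = g x) : f = g := by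
  let E := (StarAlgHom.equalizer f g).map (core n).subtype
  have hcl : IsClosed (E : Set (CuntzAlgebra n)) :=
    (isClosed_core n).isClosedEmbedding_subtypeVal.isClosedMap _
      (isClosed_eq (hom_continuous f) (hom_continuous g))
  have hlev : ∀ k, coreLevel n k ≤ E := by
    intro k
    have : coreSpan n k ≤ Subalgebra.toSubmodule E.toSubalgebra := by
      refine Submodule.span_le.2 ?_
      rintro _ ⟨μ, ν, hμ, hν, rfl⟩
      have hl := hμ.trans hν.symm
      exact ⟨⟨_, coreLevel_le_core n _ (mem_coreSpan hl)⟩, h _ μ ν hl rfl, rfl⟩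
    exact this
  have hle : core n ≤ E := StarSubalgebra.topologicalClosure_minimal (iSup_le hlev) hcl
  ext x
  obtain ⟨y, hy, hyx⟩ := hle x.2
  obtain rfl : y = x := Subtype.ext hyx
  exact hy

/-- If the limit of `u₁ ⊗ u₂ u₁* ⊗ ⋯` is `v`, then `λ_v` extends `α_u`. -/
theorem lam_eq_productAut {u : ℕ → unitary (coreLevel n 1)} {v : unitary (CuntzAlgebra n)}
    (hv : Tendsto (tensor (quot (seq u))) atTop (𝓝 (v : CuntzAlgebra n))) (x : core n) :
    lam v (x : CuntzAlgebra n) = productAut u x := by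
  have : (lam v).comp (core n).subtype
      = (core n).subtype.comp (productAut u : core n →⋆ₐ[ℂ] core n) := by
    refine core_hom_ext fun x μ ν hl hx => ?_
    have h1 := tendsto_lam_word (seq_mem_coreLevel u) (seq_mem_unitary u) hv μ
    have h2 := tendsto_lam_word (seq_mem_coreLevel u) (seq_mem_unitary u) hv ν
    have h3 := (tendsto_productAut u x).comp (tendsto_add_atTop_nat ν.length)
    change lam v (x : CuntzAlgebra n) = productAut u x
    rw [hx, map_mul, map_star]
    refine tendsto_nhds_unique ((h1.mul h2.star).congr fun k => ?_) h3
    rw [Function.comp_apply, hx, star_mul, star_mul, star_star, hl,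
      show ∀ w x y z s : CuntzAlgebra n, w * x * star y * (y * (z * s))
        = w * x * (star y * y) * z * s from fun w x y z s => by simp only [mul_assoc],
      Unitary.star_mul_self_of_mem (tensor_seq_mem_unitary u _), mul_one]
    simp only [mul_assoc]
  exact congrArg (fun f => f x) this

theorem productAut_star (u : ℕ → unitary (coreLevel n 1)) (x : core n) :
    productAut u (productAut (fun k => star (u k)) x) = x :=
  limConj_limConj (tensor_seq_mem_unitary _) (tensor_seq_mem_core _) (exists_tendsto_tensor _)
    (tensor_seq_mem_unitary _) (tensor_seq_mem_core _) (exists_tendsto_tensor _) (fun k => by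
    rw [← tensor_star (seq_mem_coreLevel _)]
    exact congrArg (fun a => tensor a k) (funext fun j => (star_star (seq u j)).symm)) x

/-- The terms for u* are W* Q* W with W = W_{k+1} and Q = Q_{k+1}. Conjugation by W is isometric, so
they are asymptotic to W* v* W, which converges to the image of v* under the automorphism of u*. -/
theorem tendsto_quot_star {u : ℕ → unitary (coreLevel n 1)} {v : core n}
    (hv : Tendsto (tensor (quot (seq u))) atTop (𝓝 (v : CuntzAlgebra n))) :
    Tendsto (tensor (quot (seq fun k => star (u k)))) atTop
      (𝓝 (productAut (fun k => star (u k)) (star v) : CuntzAlgebra n)) := by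
  set u' : ℕ → unitary (coreLevel n 1) := fun k => star (u k)
  have ht : ∀ k, tensor (seq u') k = star (tensor (seq u) k) :=
    tensor_star (seq_mem_coreLevel u)
  have h1 := (tendsto_productAut u' (star v)).comp (tendsto_add_atTop_nat 1)
  have h2 := tendsto_iff_norm_sub_tendsto_zero.1
    ((hv.comp (tendsto_add_atTop_nat 1)).star)
  refine (tendsto_add_atTop_iff_nat 1).1 (h1.congr_dist ?_)
  refine h2.congr fun k => ?_
  have e : tensor (quot (seq u')) (k + 1) = star (tensor (seq u) (k + 1))
      * star (tensor (quot (seq u)) (k + 1)) * tensor (seq u) (k + 1) := by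
    rw [tensor_quot_succ (seq_mem_coreLevel u'), tensor_quot_succ (seq_mem_coreLevel u), ht, ht,
      map_star, star_star, star_mul, star_star, mul_assoc, mul_assoc,
      Unitary.star_mul_self_of_mem (tensor_seq_mem_unitary u _), mul_one]
  rw [dist_comm, dist_eq_norm, e, Function.comp_apply, Function.comp_apply, ht, star_star,
    ← sub_mul, StarMemClass.coe_star, ← mul_sub,
    CStarRing.norm_mul_mem_unitary _ (tensor_seq_mem_unitary u _),
    CStarRing.norm_mem_unitary_mul _ (Unitary.star_mem (tensor_seq_mem_unitary u _))]

/-- On generators λ_v(λ_w(Sᵢ)) = λ_v(w) v Sᵢ, and the hypothesis turns this into v* v Sᵢ. -/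
theorem lam_lam {v w : unitary (CuntzAlgebra n)}
    (h : lam v (w : CuntzAlgebra n) = star (v : CuntzAlgebra n)) (x : CuntzAlgebra n) :
    lam v (lam w x) = x := by
  have : (lam v).comp (lam w) = StarAlgHom.id ℂ _ := by
    refine hom_ext fun i => ?_
    rw [StarAlgHom.comp_apply, lam_S, map_mul, lam_S, h, ← mul_assoc,
      Unitary.coe_star_mul_self, one_mul]
    rfl
  exact congrArg (fun f => f x) this

/-- If the limit of `u₁ ⊗ u₂ u₁* ⊗ ⋯` exists in `𝓕ₙ`, then it is a unitary `v` and `λ_v` is an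
automorphism that extends `α_u`. -/
theorem lam_of_tendsto (u : ℕ → unitary (coreLevel n 1)) (v : core n)
    (h : Tendsto (tensor (quot (seq u))) atTop (𝓝 (v : CuntzAlgebra n))) :
    ∃ hv : (v : CuntzAlgebra n) ∈ unitary (CuntzAlgebra n),
      Function.Bijective (lam ⟨(v : CuntzAlgebra n), hv⟩) ∧
      ∀ x : core n, lam ⟨(v : CuntzAlgebra n), hv⟩ (x : CuntzAlgebra n)
        = (productAut u x : CuntzAlgebra n) := by
  have hu : ∀ (u : ℕ → unitary (coreLevel n 1)) k,
      tensor (quot (seq u)) k ∈ unitary (CuntzAlgebra n) := fun u =>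
    tensor_mem_unitary (quot_mem_unitary (seq_mem_unitary u))
  have hv := isClosed_unitary.mem_of_tendsto h (Eventually.of_forall (hu u))
  have h' := tendsto_quot_star h
  set w := productAut (fun k => star (u k)) (star v) with hwdef
  have hw := isClosed_unitary.mem_of_tendsto h' (Eventually.of_forall (hu _))
  have e1 := lam_eq_productAut (v := ⟨_, hv⟩) h
  have e2 := lam_eq_productAut (v := ⟨_, hw⟩) h'
  refine ⟨hv, Function.bijective_iff_has_inverse.2 ⟨lam ⟨_, hw⟩, lam_lam ?_, lam_lam ?_⟩, e1⟩
  · change lam ⟨_, hw⟩ (v : CuntzAlgebra n) = star (w : CuntzAlgebra n)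
    rw [e2, hwdef, map_star, StarMemClass.coe_star, star_star]
  · change lam ⟨_, hv⟩ (w : CuntzAlgebra n) = star (v : CuntzAlgebra n)
    rw [e1, hwdef, productAut_star, StarMemClass.coe_star]

/-! ## Products of vectors of the Hilbert space spanned by the generators -/

/-- The linear span of the generators. -/
def genSpan (n : ℕ) : Submodule ℂ (CuntzAlgebra n) := Submodule.span ℂ (Set.range S)

theorem S_mem_genSpan (i : Fin n) : S i ∈ genSpan n := Submodule.subset_span ⟨i, rfl⟩

theorem star_S_mul_mem {t : CuntzAlgebra n} (ht : t ∈ genSpan n) (i : Fin n) :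
    ∃ c : ℂ, star (S i) * t = c • 1 := by
  induction ht using Submodule.span_induction with
  | mem x hx =>
    obtain ⟨j, rfl⟩ := hx
    by_cases hij : i = j
    · exact ⟨1, by rw [hij, (isCuntzFamily_S n).isometry, one_smul]⟩
    · exact ⟨0, by rw [(isCuntzFamily_S n).star_mul_of_ne hij, zero_smul]⟩
  | zero => exact ⟨0, by simp⟩
  | add x y _ _ hx hy =>
    obtain ⟨c, hc⟩ := hx
    obtain ⟨d, hd⟩ := hy
    exact ⟨c + d, by rw [mul_add, hc, hd, add_smul]⟩
  | smul a x _ hx =>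
    obtain ⟨c, hc⟩ := hx
    exact ⟨a * c, by rw [mul_smul_comm, hc, smul_smul]⟩

theorem star_mul_mem {s t : CuntzAlgebra n} (hs : s ∈ genSpan n) (ht : t ∈ genSpan n) :
    ∃ c : ℂ, star s * t = c • 1 := by
  induction hs using Submodule.span_induction with
  | mem x hx =>
    obtain ⟨j, rfl⟩ := hx
    exact star_S_mul_mem ht j
  | zero => exact ⟨0, by simp⟩
  | add x y _ _ hx hy =>
    obtain ⟨c, hc⟩ := hx
    obtain ⟨d, hd⟩ := hy
    exact ⟨c + d, by rw [star_add, add_mul, hc, hd, add_smul]⟩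
  | smul a x _ hx =>
    obtain ⟨c, hc⟩ := hx
    exact ⟨star a * c, by rw [star_smul, smul_mul_assoc, hc, smul_smul]⟩

theorem shift_mul_of_mem {t : CuntzAlgebra n} (ht : t ∈ genSpan n) (x : CuntzAlgebra n) :
    shift n x * t = t * x := by
  induction ht using Submodule.span_induction with
  | mem y hy =>
    obtain ⟨j, rfl⟩ := hy
    exact (S_mul j x).symm
  | zero => simp
  | add y z _ _ hy hz => rw [mul_add, add_mul, hy, hz]
  | smul a y _ hy => rw [mul_smul_comm, smul_mul_assoc, hy]

/-- This is Mₙ acting on ℂⁿ. -/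
theorem mul_mem_genSpan {a t : CuntzAlgebra n} (ha : a ∈ coreLevel n 1) (ht : t ∈ genSpan n) :
    a * t ∈ genSpan n := by
  change a ∈ coreSpan n 1 at ha
  induction ha using Submodule.span_induction with
  | mem y hy =>
    obtain ⟨μ, ν, hμ, hν, rfl⟩ := hy
    obtain ⟨i, rfl⟩ := List.length_eq_one_iff.1 hμ
    obtain ⟨j, rfl⟩ := List.length_eq_one_iff.1 hν
    obtain ⟨c, hc⟩ := star_S_mul_mem ht j
    rw [word_cons, word_cons, word_nil, mul_one, mul_one, mul_assoc, hc, mul_smul_comm, mul_one]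
    exact Submodule.smul_mem _ _ (S_mem_genSpan i)
  | zero => simp
  | add y z _ _ hy hz => rw [add_mul]; exact add_mem hy hz
  | smul c y _ hy => rw [smul_mul_assoc]; exact Submodule.smul_mem _ _ hy

/-- `vecProd t a l = t a * t (a + 1) * ⋯ * t (a + l - 1)`. -/
def vecProd (t : ℕ → CuntzAlgebra n) : ℕ → ℕ → CuntzAlgebra n
  | _, 0 => 1
  | a, l + 1 => t a * vecProd t (a + 1) l

theorem vecProd_succ' (t : ℕ → CuntzAlgebra n) (a l : ℕ) :
    vecProd t a (l + 1) = vecProd t a l * t (a + l) := by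
  induction l generalizing a with
  | zero => simp [vecProd]
  | succ l ih =>
    rw [vecProd, ih, vecProd, mul_assoc, show a + 1 + l = a + (l + 1) by omega]

theorem vecProd_isometry {t : ℕ → CuntzAlgebra n} (ht : ∀ j, star (t j) * t j = 1) (a l : ℕ) :
    star (vecProd t a l) * vecProd t a l = 1 := by
  induction l generalizing a with
  | zero => simp [vecProd]
  | succ l ih =>
    rw [vecProd, star_mul, mul_assoc, ← mul_assoc (star (t a)), ht, one_mul, ih]

theorem iterate_shift_mul_vecProd {t : ℕ → CuntzAlgebra n} (ht : ∀ j, t j ∈ genSpan n)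
    (x : CuntzAlgebra n) (a l : ℕ) :
    (shift n)^[l] x * vecProd t a l = vecProd t a l * x := by
  induction l generalizing a with
  | zero => simp [vecProd]
  | succ l ih =>
    rw [vecProd, Function.iterate_succ_apply', ← mul_assoc, shift_mul_of_mem (ht a), mul_assoc,
      ih, mul_assoc]

/-- An elementary tensor of matrices acts factorwise on an elementary tensor of vectors: passing
φᵏ(a_k) through the first k vectors turns it into a_k. -/
theorem tensor_mul_vecProd {t : ℕ → CuntzAlgebra n} (ht : ∀ j, t j ∈ genSpan n)
    (a : ℕ → CuntzAlgebra n) (k : ℕ) :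
    tensor a k * vecProd t 0 k = vecProd (fun j => a j * t j) 0 k := by
  induction k with
  | zero => simp [tensor, vecProd]
  | succ k ih =>
    rw [vecProd_succ', vecProd_succ', ← ih, tensor, zero_add, mul_assoc (tensor a k),
      ← mul_assoc ((shift n)^[k] (a k)), iterate_shift_mul_vecProd ht]
    simp only [mul_assoc]

/-- Each letter of β absorbs one vector and leaves an inner product. -/
theorem star_word_mul_vecProd {t : ℕ → CuntzAlgebra n} (ht : ∀ j, t j ∈ genSpan n)
    (β : List (Fin n)) (a l : ℕ) :
    ∃ c : ℂ, star (word β) * vecProd t a (β.length + l) = c • vecProd t (a + β.length) l := by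
  induction β generalizing a with
  | nil => exact ⟨1, by simp⟩
  | cons i β ih =>
    obtain ⟨c, hc⟩ := ih (a + 1)
    obtain ⟨d, hd⟩ := star_S_mul_mem (ht a) i
    refine ⟨d * c, ?_⟩
    rw [List.length_cons, show β.length + 1 + l = β.length + l + 1 by omega, vecProd, word_cons,
      star_mul, mul_assoc, ← mul_assoc (star (S i)), hd, smul_mul_assoc, one_mul, mul_smul_comm,
      hc, smul_smul, show a + 1 + β.length = a + (β.length + 1) by omega]

theorem star_vecProd_mul_vecProd {r t : ℕ → CuntzAlgebra n} (hr : ∀ j, r j ∈ genSpan n)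
    (ht : ∀ j, t j ∈ genSpan n) (a l : ℕ) :
    ∃ c : ℂ, star (vecProd r a l) * vecProd t a l = c • 1 := by
  induction l generalizing a with
  | zero => exact ⟨1, by simp [vecProd]⟩
  | succ l ih =>
    obtain ⟨c, hc⟩ := ih (a + 1)
    obtain ⟨d, hd⟩ := star_mul_mem (hr a) (ht a)
    refine ⟨d * c, ?_⟩
    rw [vecProd, vecProd, star_mul, mul_assoc, ← mul_assoc (star (r a)), hd, smul_mul_assoc,
      one_mul, mul_smul_comm, hc, smul_smul]

/-- The earlier pairs contract to scalars, so the orthogonal pair becomes adjacent. -/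
theorem star_vecProd_mul_vecProd_eq_zero {r t : ℕ → CuntzAlgebra n} (hr : ∀ j, r j ∈ genSpan n)
    (ht : ∀ j, t j ∈ genSpan n) {a b i l l' : ℕ} (h : star (r (a + i)) * t (b + i) = 0)
    (hl : i < l) (hl' : i < l') : star (vecProd r a l) * vecProd t b l' = 0 := by
  induction i generalizing a b l l' with
  | zero =>
    obtain ⟨l, rfl⟩ := Nat.exists_eq_succ_of_ne_zero hl.ne'
    obtain ⟨l', rfl⟩ := Nat.exists_eq_succ_of_ne_zero hl'.ne'
    rw [add_zero, add_zero] at h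
    rw [vecProd, vecProd, star_mul, mul_assoc, ← mul_assoc (star (r a)), h, zero_mul, mul_zero]
  | succ i ih =>
    obtain ⟨l, rfl⟩ := Nat.exists_eq_succ_of_ne_zero (Nat.ne_zero_of_lt hl)
    obtain ⟨l', rfl⟩ := Nat.exists_eq_succ_of_ne_zero (Nat.ne_zero_of_lt hl')
    obtain ⟨d, hd⟩ := star_mul_mem (hr a) (ht b)
    rw [vecProd, vecProd, star_mul, mul_assoc, ← mul_assoc (star (r a)), hd, smul_mul_assoc,
      one_mul, mul_smul_comm,
      ih (a := a + 1) (b := b + 1) (by rwa [add_right_comm a, add_right_comm b])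
        (by omega) (by omega), smul_zero]

/-- Two product vectors that see only scalars in the short words. -/
theorem vecProd_word_vecProd {r t : ℕ → CuntzAlgebra n} (hr : ∀ j, r j ∈ genSpan n)
    (ht : ∀ j, t j ∈ genSpan n) {m k : ℕ} (h : ∀ j, j ≠ m → star (r m) * t j = 0)
    (hk : 2 * m + 1 ≤ k) {α β : List (Fin n)} (hα : α.length ≤ m) (hβ : β.length ≤ m) :
    ∃ c : ℂ, star (vecProd r 0 k) * (word α * star (word β)) * vecProd t 0 k = c • 1 := by
  obtain ⟨c, hc⟩ := star_word_mul_vecProd hr α 0 (k - α.length)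
  obtain ⟨d, hd⟩ := star_word_mul_vecProd ht β 0 (k - β.length)
  rw [Nat.add_sub_cancel' (by omega), zero_add] at hc hd
  have hc' := congrArg star hc
  rw [star_mul, star_star, star_smul] at hc'
  have e : star (vecProd r 0 k) * (word α * star (word β)) * vecProd t 0 k
      = (star c * d) • (star (vecProd r α.length (k - α.length))
        * vecProd t β.length (k - β.length)) := by
    rw [← mul_assoc, hc', mul_assoc, hd, smul_mul_smul_comm]
  rw [e]
  by_cases hab : α.length = β.length
  · obtain ⟨b, hb⟩ := star_vecProd_mul_vecProd hr ht β.length (k - β.length)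
    exact ⟨star c * d * b, by rw [hab, hb, smul_smul]⟩
  · refine ⟨0, ?_⟩
    -- After the words are absorbed, the marked factor r_m stands at place m - |α| and faces the
    -- factor of t with index m + |β| - |α| ≠ m. The bound 2m + 1 ≤ k keeps that index within range.
    rw [star_vecProd_mul_vecProd_eq_zero hr ht (i := m - α.length) ?_ (by omega) (by omega),
      smul_zero, zero_smul]
    rw [Nat.add_sub_cancel' hα]
    exact h _ (by omega)

/-! ## The dense star subalgebra spanned by the elements `S_α S_β*` -/

/-- Equal leading letters cancel until the letters differ or one word is exhausted. -/
theorem star_word_mul_word_mem (α β : List (Fin n)) :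
    star (word α) * word β = 0 ∨ (∃ γ, star (word α) * word β = word γ) ∨
      ∃ γ : List (Fin n), star (word α) * word β = star (word γ) := by
  induction α generalizing β with
  | nil => exact Or.inr (Or.inl ⟨β, by simp⟩)
  | cons i α ih =>
    cases β with
    | nil => exact Or.inr (Or.inr ⟨i :: α, by simp⟩)
    | cons j β =>
      rw [word_cons, word_cons, star_mul, mul_assoc, ← mul_assoc (star (S i))]
      by_cases hij : i = j
      · rw [hij, (isCuntzFamily_S n).isometry, one_mul]
        exact ih β
      · rw [(isCuntzFamily_S n).star_mul_of_ne hij, zero_mul, mul_zero]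
        exact Or.inl rfl

/-- The linear span of the elements `S_α S_β*`. -/
def wordSpan (n : ℕ) : Submodule ℂ (CuntzAlgebra n) :=
  Submodule.span ℂ {x | ∃ α β : List (Fin n), x = word α * star (word β)}

theorem mem_wordSpan (α β : List (Fin n)) : word α * star (word β) ∈ wordSpan n :=
  Submodule.subset_span ⟨α, β, rfl⟩

theorem mul_mem_wordSpan {x y : CuntzAlgebra n} (hx : x ∈ wordSpan n) (hy : y ∈ wordSpan n) :
    x * y ∈ wordSpan n := by
  have h : wordSpan n * wordSpan n ≤ wordSpan n := by
    rw [wordSpan, Submodule.span_mul_span, Submodule.span_le]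
    rintro _ ⟨_, ⟨α, β, rfl⟩, _, ⟨α', β', rfl⟩, rfl⟩
    have e : word α * star (word β) * (word α' * star (word β'))
        = word α * (star (word β) * word α') * star (word β') := by simp only [mul_assoc]
    simp only [SetLike.mem_coe]
    rw [e]
    rcases star_word_mul_word_mem β α' with h | ⟨γ, h⟩ | ⟨γ, h⟩ <;> rw [h]
    · simp
    · rw [← word_append]
      exact mem_wordSpan _ _
    · rw [mul_assoc, ← star_mul, ← word_append]
      exact mem_wordSpan _ _
  exact h (Submodule.mul_mem_mul hx hy)

theorem star_mem_wordSpan {x : CuntzAlgebra n} (hx : x ∈ wordSpan n) : star x ∈ wordSpan n := by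
  induction hx using Submodule.span_induction with
  | mem x hx =>
    obtain ⟨α, β, rfl⟩ := hx
    rw [star_mul, star_star]
    exact mem_wordSpan β α
  | zero => simp
  | add x y _ _ hx hy => rw [star_add]; exact add_mem hx hy
  | smul c x _ hx => rw [star_smul]; exact Submodule.smul_mem _ _ hx

/-- `wordSpan` as a star subalgebra. -/
def wordAlg (n : ℕ) : StarSubalgebra ℂ (CuntzAlgebra n) where
  carrier := wordSpan n
  mul_mem' := mul_mem_wordSpan
  add_mem' := add_mem
  algebraMap_mem' c := by
    rw [Algebra.algebraMap_eq_smul_one]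
    exact Submodule.smul_mem _ _ (by simpa using mem_wordSpan (n := n) [] [])
  star_mem' := star_mem_wordSpan

theorem dense_wordSpan (x : CuntzAlgebra n) {ε : ℝ} (hε : 0 < ε) :
    ∃ p ∈ wordSpan n, ‖x - p‖ < ε := by
  have h := eq_top_of_closed (wordAlg n).topologicalClosure
    (StarSubalgebra.isClosed_topologicalClosure _)
    (fun i => StarSubalgebra.le_topologicalClosure _
      (show S i ∈ wordSpan n by simpa using mem_wordSpan [i] []))
  have hx : x ∈ closure (wordAlg n : Set (CuntzAlgebra n)) := by
    rw [← StarSubalgebra.topologicalClosure_coe, h]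
    exact Set.mem_univ x
  obtain ⟨p, hp, hxp⟩ := Metric.mem_closure_iff.1 hx ε hε
  exact ⟨p, hp, by rwa [← dist_eq_norm]⟩

/-- An element of `wordSpan` is seen as a scalar by suitable long product vectors. -/
theorem vecProd_mul_mul_vecProd {r t : ℕ → ℕ → CuntzAlgebra n} (hr : ∀ m j, r m j ∈ genSpan n)
    (ht : ∀ m j, t m j ∈ genSpan n) (h : ∀ m j, j ≠ m → star (r m m) * t m j = 0)
    {p : CuntzAlgebra n} (hp : p ∈ wordSpan n) :
    ∃ m₀, ∀ m ≥ m₀, ∀ k ≥ 2 * m + 1, ∃ c : ℂ,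
      star (vecProd (r m) 0 k) * p * vecProd (t m) 0 k = c • 1 := by
  induction hp using Submodule.span_induction with
  | mem x hx =>
    obtain ⟨α, β, rfl⟩ := hx
    exact ⟨max α.length β.length, fun m hm k hk => vecProd_word_vecProd (hr m) (ht m) (h m) hk
      ((le_max_left _ _).trans hm) ((le_max_right _ _).trans hm)⟩
  | zero => exact ⟨0, fun m _ k _ => ⟨0, by simp⟩⟩
  | add x y _ _ hx hy =>
    obtain ⟨m₁, h₁⟩ := hx
    obtain ⟨m₂, h₂⟩ := hy
    refine ⟨max m₁ m₂, fun m hm k hk => ?_⟩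
    obtain ⟨c, hc⟩ := h₁ m ((le_max_left _ _).trans hm) k hk
    obtain ⟨d, hd⟩ := h₂ m ((le_max_right _ _).trans hm) k hk
    exact ⟨c + d, by rw [mul_add, add_mul, hc, hd, add_smul]⟩
  | smul a x _ hx =>
    obtain ⟨m₁, h₁⟩ := hx
    refine ⟨m₁, fun m hm k hk => ?_⟩
    obtain ⟨c, hc⟩ := h₁ m hm k hk
    exact ⟨a * c, by rw [mul_smul_comm, smul_mul_assoc, hc, smul_smul]⟩

/-! ## Relative commutants -/

/-- The commutant of `𝓕ₙᵏ` is `φᵏ(𝒪ₙ)`. -/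
theorem exists_iterate_shift_eq (hn : 0 < n) {k : ℕ} {z : CuntzAlgebra n}
    (hz : ∀ x ∈ coreLevel n k, Commute z x) : ∃ y, (shift n)^[k] y = z := by
  induction k generalizing z with
  | zero => exact ⟨z, rfl⟩
  | succ k ih =>
    let i : Fin n := ⟨0, hn⟩
    -- Commuting z past the matrix units Sⱼ Sᵢ* moves it out of each summand, and the range
    -- projections sum to 1.
    have hz' : shift n (star (S i) * z * S i) = z := by
      have h : ∀ j, S j * (star (S i) * z * S i) * star (S j) = z * (S j * star (S j)) := by
        intro j
        have h1 : S j * star (S i) ∈ coreLevel n (k + 1) :=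
          coreLevel_mono n (by omega) (Submodule.subset_span ⟨[j], [i], rfl, rfl, by simp⟩ :
            S j * star (S i) ∈ coreLevel n 1)
        calc _ = S j * star (S i) * z * (S i * star (S j)) := by simp only [mul_assoc]
          _ = z * (S j * (star (S i) * S i) * star (S j)) := by
            rw [← (hz _ h1).eq]; simp only [mul_assoc]
          _ = _ := by rw [(isCuntzFamily_S n).isometry, mul_one]
      simp_rw [shift_apply, h, ← Finset.mul_sum, (isCuntzFamily_S n).sum_range, mul_one]
    obtain ⟨y, hy⟩ := ih (z := star (S i) * z * S i) fun x hx => by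
      have h1 := (hz _ (shift_mem_coreLevel hx)).eq
      have h2 := congrArg star (S_mul i (star x))
      rw [star_mul, star_star, star_mul, map_star, star_star] at h2
      rw [Commute, SemiconjBy, mul_assoc _ (S i), S_mul, ← mul_assoc, mul_assoc (star (S i)), h1,
        ← mul_assoc, ← mul_assoc, ← mul_assoc, h2]
    exact ⟨y, by rw [Function.iterate_succ_apply', hy, hz']⟩

theorem norm_iterate_shift_le (k : ℕ) (x : CuntzAlgebra n) : ‖(shift n)^[k] x‖ ≤ ‖x‖ := by
  induction k with
  | zero => exact le_rfl
  | succ k ih =>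
    rw [Function.iterate_succ_apply']
    exact (NonUnitalStarAlgHom.norm_apply_le (shift n) _).trans ih

/-- An element `v` such that `v = (q₀ ⊗ ⋯ ⊗ qₖ₋₁) φᵏ(yₖ)` for all `k` is approximated by multiples of
`q₀ ⊗ ⋯ ⊗ qₖ₋₁`. -/
theorem exists_norm_sub_smul_tensor_le (hn : 2 ≤ n) {q : ℕ → CuntzAlgebra n}
    (hq : ∀ k, q k ∈ coreLevel n 1) (hu : ∀ k, q k ∈ unitary (CuntzAlgebra n))
    {v : CuntzAlgebra n}
    (hv : ∀ k, ∃ y, star (tensor q k) * v = (shift n)^[k] y) {ε : ℝ} (hε : 0 < ε) :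
    ∃ k₀, ∀ k ≥ k₀, ∃ c : ℂ, ‖v - c • tensor q k‖ ≤ ε := by
  let i₀ : Fin n := ⟨0, by omega⟩
  let i₁ : Fin n := ⟨1, by omega⟩
  have hne : i₁ ≠ i₀ := by simp [i₀, i₁]
  -- Position m carries the mark. The factor q_m* is put into t so that r_m = q_m t_m is exactly S
  -- i₁, orthogonal to S i₀, which is every other factor of t; no condition on q is needed.
  let t : ℕ → ℕ → CuntzAlgebra n := fun m j => if j = m then star (q m) * S i₁ else S i₀
  let r : ℕ → ℕ → CuntzAlgebra n := fun m j => q j * t m j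
  have ht : ∀ m j, t m j ∈ genSpan n := by
    intro m j
    simp only [t]
    split_ifs
    · exact mul_mem_genSpan (star_mem (hq m)) (S_mem_genSpan _)
    · exact S_mem_genSpan _
  have hr : ∀ m j, r m j ∈ genSpan n := fun m j => mul_mem_genSpan (hq j) (ht m j)
  have hrt : ∀ m j, j ≠ m → star (r m m) * t m j = 0 := by
    intro m j hj
    simp only [r, t, if_true, if_neg hj, ← mul_assoc, Unitary.mul_star_self_of_mem (hu m),
      one_mul]
    exact (isCuntzFamily_S n).star_mul_of_ne hne
  have hti : ∀ m j, star (t m j) * t m j = 1 := by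
    intro m j
    simp only [t]
    split_ifs
    · rw [star_mul, star_star, mul_assoc, ← mul_assoc (q m), Unitary.mul_star_self_of_mem (hu m),
        one_mul, (isCuntzFamily_S n).isometry]
    · exact (isCuntzFamily_S n).isometry _
  have hri : ∀ m j, star (r m j) * r m j = 1 := by
    intro m j
    simp only [r]
    rw [star_mul, mul_assoc, ← mul_assoc (star (q j)), Unitary.star_mul_self_of_mem (hu j),
      one_mul, hti]
  obtain ⟨p, hp, hvp⟩ := dense_wordSpan v hε
  obtain ⟨m, hm⟩ := vecProd_mul_mul_vecProd hr ht hrt hp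
  refine ⟨2 * m + 1, fun k hk => ?_⟩
  obtain ⟨c, hc⟩ := hm m le_rfl k hk
  obtain ⟨y, hy⟩ := hv k
  have hR := vecProd_isometry (hri m) 0 k
  have hT := vecProd_isometry (hti m) 0 k
  have hRT : vecProd (r m) 0 k = tensor q k * vecProd (t m) 0 k :=
    (tensor_mul_vecProd (ht m) q k).symm
  -- Since R = Q T, the compression of v is T* φᵏ(y) T = T* T y = y.
  have hyv : star (vecProd (r m) 0 k) * v * vecProd (t m) 0 k = y := by
    rw [hRT, star_mul, mul_assoc (star (vecProd _ _ _)), hy, mul_assoc,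
      iterate_shift_mul_vecProd (ht m), ← mul_assoc, hT, one_mul]
  have hyc : ‖y - c • 1‖ ≤ ε := by
    rw [← hc, ← hyv, ← sub_mul, ← mul_sub]
    have h1 := norm_le_one_of_isometry hT
    have h2 := norm_le_one_of_isometry hR
    rw [← norm_star] at h2
    calc _ ≤ ‖star (vecProd (r m) 0 k)‖ * ‖v - p‖ * ‖vecProd (t m) 0 k‖ :=
          (norm_mul_le _ _).trans (by gcongr; exact norm_mul_le _ _)
      _ ≤ 1 * ‖v - p‖ * 1 := by gcongr
      _ ≤ ε := by linarith
  have hun := tensor_mem_unitary hu k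
  refine ⟨c, ?_⟩
  have e : v - c • tensor q k = tensor q k * (shift n)^[k] (y - c • 1) := by
    have h1 : (shift n)^[k] (y - c • 1) = star (tensor q k) * v - c • 1 := by
      rw [iterate_map_sub, ← hy]
      congr 1
      exact Function.iterate_fixed (by rw [map_smul, map_one]) k
    rw [h1, mul_sub, ← mul_assoc, Unitary.mul_star_self_of_mem hun, one_mul, mul_smul_comm,
      mul_one]
  rw [e, CStarRing.norm_mem_unitary_mul _ hun]
  exact (norm_iterate_shift_le _ _).trans hyc

/-! ## A Cuntz family on `ℓ²(ℕ)` -/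

/-- A bijection of `Fin n` × ℕ with ℕ splits an orthonormal basis into n copies of itself; Tᵢ maps
the basis onto the i-th copy. This supplies a nonzero model, hence 𝒪ₙ ≠ 0. -/
theorem exists_isCuntzFamily (hn : 0 < n) :
    ∃ T : Fin n → (lp (fun _ : ℕ => ℂ) 2 →L[ℂ] lp (fun _ : ℕ => ℂ) 2), IsCuntzFamily T := by
  have : Nonempty (Fin n) := ⟨⟨0, hn⟩⟩
  let b : HilbertBasis ℕ ℂ (lp (fun _ : ℕ => ℂ) 2) := ⟨LinearIsometryEquiv.refl ℂ _⟩
  obtain ⟨σ⟩ := nonempty_equiv_of_countable (α := Fin n × ℕ) (β := ℕ)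
  have ho : ∀ i : Fin n, Orthonormal ℂ (fun k => b (σ (i, k))) := fun i =>
    b.orthonormal.comp (fun k => σ (i, k)) fun k l h => by simpa using h
  let T : Fin n → (lp (fun _ : ℕ => ℂ) 2 →L[ℂ] lp (fun _ : ℕ => ℂ) 2) := fun i =>
    (ho i).orthogonalFamily.linearIsometry.toContinuousLinearMap
  have hT : ∀ i k, T i (b k) = b (σ (i, k)) := by
    intro i k
    rw [show b k = lp.single 2 k 1 from (b.repr_symm_single k).symm]
    change (ho i).orthogonalFamily.linearIsometry _ = _
    rw [(ho i).orthogonalFamily.linearIsometry_apply_single, LinearIsometry.toSpanSingleton_apply,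
      one_smul]
  have hiso : ∀ i, star (T i) * T i = 1 := fun i =>
    (ContinuousLinearMap.norm_map_iff_adjoint_comp_self (T i)).1
      (ho i).orthogonalFamily.linearIsometry.norm_map
  have hsame : ∀ i k, star (T i) (b (σ (i, k))) = b k := fun i k => by
    rw [← hT]
    exact congrArg (fun f => f (b k)) (hiso i)
  have hdiff : ∀ i j k, i ≠ j → star (T i) (b (σ (j, k))) = 0 := fun i j k hij => by
    refine b.repr.injective (lp.ext (funext fun l => ?_))
    rw [b.repr_apply_apply, ContinuousLinearMap.star_eq_adjoint,
      ContinuousLinearMap.adjoint_inner_right, hT, b.orthonormal.2 (by simp [hij])]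
    simp
  refine ⟨T, hiso, ContinuousLinearMap.ext_on
    (Submodule.dense_iff_topologicalClosure_eq_top.2 b.dense_span) ?_⟩
  rintro _ ⟨l, rfl⟩
  obtain ⟨⟨j, k⟩, rfl⟩ := σ.surjective l
  rw [sum_apply, Finset.sum_eq_single j]
  · rw [mul_apply_eq_comp, hsame, hT]
    rfl
  · intro i _ hij
    rw [mul_apply_eq_comp, hdiff i j k hij, map_zero]
  · simp

theorem nontrivial_cuntzAlgebra (hn : 0 < n) : Nontrivial (CuntzAlgebra n) := by
  obtain ⟨T, hT⟩ := exists_isCuntzFamily hn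
  have : Nontrivial (lp (fun _ : ℕ => ℂ) 2) :=
    ⟨lp.single 2 0 1, 0, fun h => by
      have := congrArg (fun f : lp (fun _ : ℕ => ℂ) 2 => f 0) h
      simp at this⟩
  obtain ⟨f, -⟩ := exists_lift T hT
  exact f.toRingHom.domain_nontrivial

/-! ## Extensions of `α_u` -/

/-- Peel off the first letters: v φ(W) S_l = v S_l W = ρ(S_l) W. This passes an implementing unitary
from one level of 𝓕ₙ to the next. -/
theorem hom_core_conj {ρ : CuntzAlgebra n →⋆ₐ[ℂ] CuntzAlgebra n}
    {v W : CuntzAlgebra n} (hv : ∀ i, v * S i = ρ (S i)) {k : ℕ}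
    (h : ∀ x ∈ coreLevel n k, ρ x = W * x * star W) {x : CuntzAlgebra n}
    (hx : x ∈ coreLevel n (k + 1)) :
    ρ x = v * shift n W * x * star (v * shift n W) := by
  change x ∈ coreSpan n (k + 1) at hx
  induction hx using Submodule.span_induction with
  | mem x hx =>
    obtain ⟨μ, ν, hμ, hν, rfl⟩ := hx
    obtain ⟨i, μ, rfl⟩ := List.exists_cons_of_length_eq_add_one hμ
    obtain ⟨j, ν, rfl⟩ := List.exists_cons_of_length_eq_add_one hν
    have hy : word μ * star (word ν) ∈ coreLevel n k := by
      have hl : ν.length = k := by simpa using hν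
      rw [← hl]
      exact mem_coreSpan (by simpa [hl] using hμ)
    have h1 : ∀ l, v * shift n W * S l = ρ (S l) * W := fun l => by
      rw [mul_assoc, ← S_mul, ← mul_assoc, hv]
    have e : word (i :: μ) * star (word (j :: ν))
        = S i * (word μ * star (word ν)) * star (S j) := by simp [mul_assoc]
    rw [e, map_mul, map_mul, map_star, h _ hy]
    calc _ = (ρ (S i) * W) * (word μ * star (word ν)) * star (ρ (S j) * W) := by
          rw [star_mul]; simp only [mul_assoc]
      _ = _ := by rw [← h1, ← h1, star_mul _ (S j)]; simp only [mul_assoc]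
  | zero => simp
  | add x y _ _ hx hy => rw [map_add, hx, hy]; simp only [mul_add, add_mul]
  | smul c x _ hx => rw [map_smul, hx, mul_smul_comm, smul_mul_assoc]

/-- If `ρ` extends `α_u` and `ρ = λ_v`, then `v = (u₁ ⊗ u₂ u₁* ⊗ ⋯ ⊗ uₖ uₖ₋₁*) φᵏ(y)` for some `y`. -/
theorem exists_star_tensor_quot_mul (hn : 0 < n) {u : ℕ → unitary (coreLevel n 1)}
    {ρ : CuntzAlgebra n →⋆ₐ[ℂ] CuntzAlgebra n}
    (hρ : ∀ x : core n, ρ (x : CuntzAlgebra n) = (productAut u x : CuntzAlgebra n))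
    {v : CuntzAlgebra n} (hvu : v ∈ unitary (CuntzAlgebra n)) (hv : ∀ i, v * S i = ρ (S i))
    (k : ℕ) : ∃ y, star (tensor (quot (seq u)) k) * v = (shift n)^[k] y := by
  cases k with
  | zero => exact ⟨v, by simp [tensor]⟩
  | succ k =>
    have hlev : ∀ k, ∀ x ∈ coreLevel n k,
        ρ x = tensor (seq u) k * x * star (tensor (seq u) k) := fun k x hx =>
      (hρ ⟨x, coreLevel_le_core n k hx⟩).trans (productAut_apply u k _ hx)
    have hW := tensor_seq_mem_unitary u
    have hφ := Unitary.map_mem (shift n) (hW k)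
    have hφl := shift_mem_coreLevel (tensor_seq_mem_coreLevel u k)
    have hq := tensor_mem_unitary (quot_mem_unitary (seq_mem_unitary u)) (k + 1)
    refine (exists_iterate_shift_eq hn fun x hx => ?_).imp fun y hy => hy.symm
    set F := shift n (tensor (seq u) k) with hF
    have hx' : star F * x * F ∈ coreLevel n (k + 1) := mul_mem (mul_mem (star_mem hφl) hx) hφl
    have e1 := hom_core_conj hv (hlev k) hx'
    rw [hlev _ _ hx', ← hF] at e1
    -- Both W_{k+1} and v φ(W_k) implement ρ on 𝓕ₙᵏ⁺¹; undoing the conjugation by φ(W_k), which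
    -- preserves this level, compares Q_{k+1} with v.
    have e2 : tensor (quot (seq u)) (k + 1) * x * star (tensor (quot (seq u)) (k + 1))
        = v * x * star v := by
      rw [tensor_quot_succ (seq_mem_coreLevel u), star_mul, star_star]
      calc _ = tensor (seq u) (k + 1) * (star F * x * F) * star (tensor (seq u) (k + 1)) := by
            simp only [mul_assoc, hF]
        _ = v * (F * star F) * x * (F * star F) * star v := by
            rw [e1, star_mul]; simp only [mul_assoc]
        _ = _ := by rw [Unitary.mul_star_self_of_mem hφ, mul_one, mul_one]
    set q := tensor (quot (seq u)) (k + 1)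
    calc star q * v * x = star q * (v * x * star v) * v := by
          rw [mul_assoc (star q) (v * x * star v), mul_assoc (v * x),
            Unitary.star_mul_self_of_mem hvu, mul_one]
          simp only [mul_assoc]
      _ = (star q * q) * x * star q * v := by rw [← e2]; simp only [mul_assoc]
      _ = x * (star q * v) := by
          rw [Unitary.star_mul_self_of_mem hq, one_mul, mul_assoc]

/-! ### Choice of phases -/

/-- The phases eⱼ₊₁ ēⱼ of the successive quotients telescope, so only the last one survives. -/
theorem tensor_quot_smul {e : ℕ → ℂ} (he : ∀ k, star (e k) * e k = 1) (a : ℕ → CuntzAlgebra n)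
    (k : ℕ) : tensor (quot fun j => e j • a j) (k + 1) = e k • tensor (quot a) (k + 1) := by
  induction k with
  | zero => simp [tensor, quot]
  | succ k ih =>
    have h : (shift n)^[k + 1] ((e (k + 1) * star (e k)) • (a (k + 1) * star (a k)))
        = (e (k + 1) * star (e k)) • (shift n)^[k + 1] (a (k + 1) * star (a k)) :=
      Function.Commute.iterate_left (fun x => map_smul (shift n) _ x) (k + 1) _
    rw [tensor, ih, quot, star_smul, smul_mul_smul_comm, h, smul_mul_smul_comm, tensor.eq_2 _ (k + 1),
      quot, mul_comm (e (k + 1)), ← mul_assoc, mul_comm (e k), he, one_mul]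

theorem star_exp_mul_exp (θ : ℝ) :
    star (Complex.exp (θ * Complex.I)) * Complex.exp (θ * Complex.I) = 1 := by
  rw [Complex.star_def, ← Complex.exp_conj, ← Complex.exp_add]
  simp

/-- Comparing norms of unitaries shows that |c| is within ε of 1, so replacing c by its phase costs
at most another ε. -/
theorem exists_phase_norm_sub_le {A : Type*} [CStarAlgebra A] [Nontrivial A] {v w : A}
    (hv : v ∈ unitary A) (hw : w ∈ unitary A) {c : ℂ} {ε : ℝ} (h : ‖v - c • w‖ ≤ ε) :
    ∃ θ : ℝ, ‖v - Complex.exp (θ * Complex.I) • w‖ ≤ 2 * ε := by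
  refine ⟨c.arg, ?_⟩
  have hv1 := CStarRing.norm_of_mem_unitary hv
  have hw1 := CStarRing.norm_of_mem_unitary hw
  have h1 : |‖c‖ - 1| ≤ ε := by
    have := abs_norm_sub_norm_le (c • w) v
    rw [norm_smul, hw1, hv1, mul_one, norm_sub_rev] at this
    exact this.trans h
  have h2 : c - Complex.exp (c.arg * Complex.I)
      = ((‖c‖ - 1 : ℝ) : ℂ) * Complex.exp (c.arg * Complex.I) := by
    conv_lhs => rw [← Complex.norm_mul_exp_arg_mul_I c]
    push_cast
    simp [sub_mul]
  calc _ = ‖(v - c • w) + (c - Complex.exp (c.arg * Complex.I)) • w‖ := by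
        rw [sub_smul]; congr 1; abel
    _ ≤ ‖v - c • w‖ + ‖(c - Complex.exp (c.arg * Complex.I)) • w‖ := norm_add_le _ _
    _ ≤ ε + ε := by
        refine add_le_add h ?_
        rw [norm_smul, hw1, mul_one, h2, norm_mul, Complex.norm_exp_ofReal_mul_I, mul_one,
          Complex.norm_real]
        exact h1
    _ = 2 * ε := by ring

/-- The phase obtained from an approximation depends on ε; a minimizer over the compact circle
serves every ε at once. -/
theorem exists_phase_minimizing {E : Type*} [NormedAddCommGroup E] [NormedSpace ℂ E] (v w : E) :
    ∃ θ : ℝ, ∀ θ' : ℝ, ‖v - Complex.exp (θ * Complex.I) • w‖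
      ≤ ‖v - Complex.exp (θ' * Complex.I) • w‖ := by
  obtain ⟨z, -, hz⟩ := (isCompact_univ (X := Circle)).exists_isMinOn Set.univ_nonempty
    (f := fun z : Circle => ‖v - (z : ℂ) • w‖) (by fun_prop)
  refine ⟨Complex.arg z, fun θ' => ?_⟩
  have h := hz (Set.mem_univ (Circle.exp θ'))
  have e : Complex.exp (Complex.arg z * Complex.I) = z := by
    have := Complex.norm_mul_exp_arg_mul_I (z : ℂ)
    rwa [Circle.norm_coe, Complex.ofReal_one, one_mul] at this
  rw [e]
  simpa using h

/-- If `α_u` extends to an endomorphism, then the limit exists for a suitable choice of phases. -/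
theorem exists_tendsto_of_extends (hn : 2 ≤ n) {u : ℕ → unitary (coreLevel n 1)}
    {ρ : CuntzAlgebra n →⋆ₐ[ℂ] CuntzAlgebra n}
    (hρ : ∀ x : core n, ρ (x : CuntzAlgebra n) = (productAut u x : CuntzAlgebra n)) :
    ∃ θ : ℕ → ℝ, ∃ v : core n,
      Tendsto (fun k => tensor (quot fun j => Complex.exp (θ j * Complex.I) • seq u j) k)
        atTop (𝓝 (v : CuntzAlgebra n)) := by
  have := nontrivial_cuntzAlgebra (n := n) (by omega)
  have hS := isCuntzFamily_S n
  -- The unitary with ρ = λ_v.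
  let v := ∑ i, ρ (S i) * star (S i)
  have hvS : ∀ i, v * S i = ρ (S i) := by
    intro i
    simp only [v, Finset.sum_mul]
    rw [Finset.sum_eq_single i, mul_assoc, hS.isometry, mul_one]
    · intro j _ hj
      rw [mul_assoc, hS.star_mul_of_ne hj, mul_zero]
    · simp
  have hvu : v ∈ unitary (CuntzAlgebra n) := by
    have h1 : ∀ i, star v * ρ (S i) = S i := by
      intro i
      simp only [v, star_sum, star_mul, star_star, Finset.sum_mul, ← map_star]
      rw [Finset.sum_eq_single i, mul_assoc, ← map_mul, hS.isometry, map_one, mul_one]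
      · intro j _ hj
        rw [mul_assoc, ← map_mul, hS.star_mul_of_ne hj, map_zero, mul_zero]
      · simp
    refine Unitary.mem_iff.2 ⟨?_, ?_⟩
    · calc star v * v = ∑ i, star v * (ρ (S i) * star (S i)) := Finset.mul_sum ..
        _ = 1 := by simp_rw [← mul_assoc, h1, hS.sum_range]
    · calc v * star v = ∑ i, v * S i * star (ρ (S i)) := by
            rw [show star v = ∑ i, S i * star (ρ (S i)) by simp [v, star_sum], Finset.mul_sum]
            simp only [mul_assoc]
        _ = 1 := by
            simp_rw [hvS, ← map_star, ← map_mul, ← map_sum, hS.sum_range, map_one]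
  set q := quot (seq u)
  have hq : ∀ k, q k ∈ coreLevel n 1 := quot_mem_coreLevel (seq_mem_coreLevel u)
  have hqu : ∀ k, q k ∈ unitary (CuntzAlgebra n) := quot_mem_unitary (seq_mem_unitary u)
  -- The k-th phase ends up on the tensor with k + 1 factors, hence the shift.
  choose θ hθ using fun k => exists_phase_minimizing v (tensor q (k + 1))
  have hlim : Tendsto (tensor (quot fun j => Complex.exp (θ j * Complex.I) • seq u j)) atTop
      (𝓝 v) := by
    refine (tendsto_add_atTop_iff_nat 1).1 (Metric.tendsto_atTop.2 fun ε hε => ?_)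
    obtain ⟨k₀, hk₀⟩ := exists_norm_sub_smul_tensor_le hn hq hqu
      (exists_star_tensor_quot_mul (by omega) hρ hvu hvS) (ε := ε / 3) (by linarith)
    refine ⟨k₀, fun k hk => ?_⟩
    obtain ⟨c, hc⟩ := hk₀ (k + 1) (by omega)
    obtain ⟨θ', hθ'⟩ := exists_phase_norm_sub_le hvu (tensor_mem_unitary hqu (k + 1)) hc
    rw [dist_comm, dist_eq_norm, tensor_quot_smul (fun k => star_exp_mul_exp (θ k))]
    linarith [hθ k θ']
  have hmem : ∀ k, tensor (quot fun j => Complex.exp (θ j * Complex.I) • seq u j) k ∈ core n :=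
    fun k => coreLevel_le_core n k (tensor_mem_coreLevel
      (quot_mem_coreLevel fun j =>
        SMulMemClass.smul_mem (Complex.exp (θ j * Complex.I)) (seq_mem_coreLevel u j)) k)
  exact ⟨θ, ⟨v, (isClosed_core n).mem_of_tendsto hlim (Eventually.of_forall hmem)⟩, hlim⟩

/-! ## An automorphism of `𝓕ₙ` that does not extend -/

theorem norm_S [Nontrivial (CuntzAlgebra n)] (i : Fin n) : ‖(S i : CuntzAlgebra n)‖ = 1 := by
  have h : ‖(S i : CuntzAlgebra n)‖ * ‖(S i : CuntzAlgebra n)‖ = 1 := by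
    rw [← CStarRing.norm_star_mul_self, (isCuntzFamily_S n).isometry, norm_one]
  nlinarith [norm_nonneg (S i : CuntzAlgebra n)]

/-- φ is isometric because y = Sᵢ* φ(y) Sᵢ recovers y by a contractive compression. -/
theorem norm_iterate_shift (hn : 0 < n) (k : ℕ) (x : CuntzAlgebra n) :
    ‖(shift n)^[k] x‖ = ‖x‖ := by
  refine le_antisymm (norm_iterate_shift_le k x) ?_
  induction k with
  | zero => exact le_rfl
  | succ k ih =>
    refine ih.trans ?_
    rw [Function.iterate_succ_apply']
    set y := (shift n)^[k] x
    let i : Fin n := ⟨0, hn⟩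
    have h := norm_le_one_of_isometry ((isCuntzFamily_S n).isometry i)
    have h' := h
    rw [← norm_star] at h'
    have e : y = star (S i) * shift n y * S i := by
      rw [mul_assoc, ← S_mul, ← mul_assoc, (isCuntzFamily_S n).isometry, one_mul]
    calc ‖y‖ = ‖star (S i) * shift n y * S i‖ := by rw [← e]
      _ ≤ ‖(star (S i) : CuntzAlgebra n)‖ * ‖shift n y‖ * ‖(S i : CuntzAlgebra n)‖ :=
        (norm_mul_le _ _).trans (by gcongr; exact norm_mul_le _ _)
      _ ≤ 1 * ‖shift n y‖ * 1 := by gcongr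
      _ = ‖shift n y‖ := by ring

/-- If the tensor products of `a` converge and `a` is unitary, then `a` tends to `1`. -/
theorem tendsto_norm_sub_one_of_tendsto_tensor (hn : 0 < n) {a : ℕ → CuntzAlgebra n}
    (ha : ∀ k, a k ∈ unitary (CuntzAlgebra n)) {v : CuntzAlgebra n}
    (h : Tendsto (tensor a) atTop (𝓝 v)) : Tendsto (fun k => ‖a k - 1‖) atTop (𝓝 0) := by
  have h1 := ((h.comp (tendsto_add_atTop_nat 1)).sub h).norm
  rw [sub_self, norm_zero] at h1
  refine h1.congr fun k => ?_
  -- Consecutive terms differ by a unitary times φᵏ(a_k - 1), so the norm of the difference is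
  -- exactly ‖a_k - 1‖.
  have e : tensor a (k + 1) - tensor a k = tensor a k * (shift n)^[k] (a k - 1) := by
    rw [iterate_map_sub, iterate_map_one, mul_sub, mul_one, tensor]
  rw [Function.comp_apply, e, CStarRing.norm_mem_unitary_mul _ (tensor_mem_unitary ha k),
    norm_iterate_shift hn]

/-- The symmetry `1 - 2 Sᵢ Sᵢ*` of `𝓕ₙ¹`. -/
def symmetry (i : Fin n) : CuntzAlgebra n := 1 - (2 : ℂ) • (S i * star (S i))

theorem symmetry_mem (i : Fin n) : symmetry i ∈ coreLevel n 1 :=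
  sub_mem (one_mem _) (SMulMemClass.smul_mem _
    (Submodule.subset_span ⟨[i], [i], rfl, rfl, by simp⟩ : S i * star (S i) ∈ coreLevel n 1))

theorem star_symmetry (i : Fin n) : star (symmetry i) = symmetry i := by
  simp [symmetry, star_smul]

theorem symmetry_mul_self (i : Fin n) : symmetry i * symmetry i = 1 := by
  have h : S i * star (S i) * (S i * star (S i)) = (S i * star (S i) : CuntzAlgebra n) := by
    rw [mul_assoc, ← mul_assoc (star (S i)), (isCuntzFamily_S n).isometry, one_mul]
  simp only [symmetry, sub_mul, mul_sub, one_mul, mul_one, smul_mul_smul_comm, h]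
  module

theorem symmetry_mul_S_self (i : Fin n) : symmetry i * S i = -S i := by
  rw [symmetry, sub_mul, one_mul, smul_mul_assoc, mul_assoc, (isCuntzFamily_S n).isometry,
    mul_one]
  module

theorem symmetry_mul_S_of_ne {i j : Fin n} (h : i ≠ j) : symmetry i * S j = S j := by
  rw [symmetry, sub_mul, one_mul, smul_mul_assoc, mul_assoc,
    (isCuntzFamily_S n).star_mul_of_ne h]
  simp

/-- Sᵢ and Sⱼ act as eigenvectors of c • `symmetry i` - 1 with eigenvalues -c - 1 and c - 1. These
sum to -2, so one has modulus at least 1. -/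
theorem one_le_norm_smul_symmetry_sub_one [Nontrivial (CuntzAlgebra n)] {i j : Fin n}
    (h : i ≠ j) (c : ℂ) : 1 ≤ ‖c • symmetry i - (1 : CuntzAlgebra n)‖ := by
  have key : ∀ (l : Fin n) (d : ℂ), (c • symmetry i - (1 : CuntzAlgebra n)) * S l = d • S l →
      ‖d‖ ≤ ‖c • symmetry i - (1 : CuntzAlgebra n)‖ := by
    intro l d hd
    have := norm_mul_le (c • symmetry i - (1 : CuntzAlgebra n)) (S l)
    rwa [hd, norm_smul, norm_S, mul_one, mul_one] at this
  have h1 := key i (-c - 1) (by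
    rw [sub_mul, smul_mul_assoc, symmetry_mul_S_self, one_mul]; module)
  have h2 := key j (c - 1) (by
    rw [sub_mul, smul_mul_assoc, symmetry_mul_S_of_ne h, one_mul]; module)
  have h3 : (2 : ℝ) ≤ ‖-c - 1‖ + ‖c - 1‖ := by
    have := norm_add_le (-c - 1) (c - 1)
    rw [show -c - 1 + (c - 1) = -2 by ring, norm_neg] at this
    simpa using this
  linarith

theorem not_surjective_restrict (hn : 2 ≤ n) : ¬ Function.Surjective (restrict n) := by
  intro hsurj
  have := nontrivial_cuntzAlgebra (n := n) (by omega)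
  let i₀ : Fin n := ⟨0, by omega⟩
  let i₁ : Fin n := ⟨1, by omega⟩
  have hne : i₀ ≠ i₁ := by simp [i₀, i₁]
  let w : unitary (coreLevel n 1) := ⟨⟨symmetry i₀, symmetry_mem i₀⟩, Unitary.mem_iff.2
    ⟨Subtype.ext (by simp [star_symmetry, symmetry_mul_self]),
      Subtype.ext (by simp [star_symmetry, symmetry_mul_self])⟩⟩
  -- Powers of w make every successive quotient equal to w itself.
  let u : ℕ → unitary (coreLevel n 1) := fun k => w ^ k
  have hu : ∀ k, seq u (k + 1) * star (seq u k) = symmetry i₀ := by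
    intro k
    have : u (k + 1) * star (u k) = w := by
      simp only [u]
      rw [pow_succ', mul_assoc, Unitary.mul_star_self, mul_one]
    exact congrArg (fun x : unitary (coreLevel n 1) => ((x : coreLevel n 1) : CuntzAlgebra n)) this
  obtain ⟨e, he⟩ := hsurj (productAut u)
  obtain ⟨θ, v, hv⟩ := exists_tendsto_of_extends hn (u := u)
    (ρ := (e.1 : CuntzAlgebra n →⋆ₐ[ℂ] CuntzAlgebra n)) fun x => by rw [← he]; rfl
  have hmem : ∀ j, Complex.exp (θ j * Complex.I) • seq u j ∈ unitary (CuntzAlgebra n) :=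
    fun j => Unitary.mem_iff.2 ⟨by
      rw [star_smul, smul_mul_smul_comm, star_exp_mul_exp,
        Unitary.star_mul_self_of_mem (seq_mem_unitary u j), one_smul], by
      rw [star_smul, smul_mul_smul_comm, mul_comm, star_exp_mul_exp,
        Unitary.mul_star_self_of_mem (seq_mem_unitary u j), one_smul]⟩
  -- The shift by one skips the zeroth entry, which is not a quotient.
  have h1 := (tendsto_norm_sub_one_of_tendsto_tensor (by omega) (quot_mem_unitary hmem) hv).comp
    (tendsto_add_atTop_nat 1)
  have h2 : (1 : ℝ) ≤ 0 := ge_of_tendsto' h1 fun k => by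
    rw [Function.comp_apply, quot, star_smul, smul_mul_smul_comm, hu]
    exact one_le_norm_smul_symmetry_sub_one hne _
  linarith

end

end Cuntz

theorem theorem2p1 (n : ℕ) (hn : 2 ≤ n) :
    (∀ u : ℕ → unitary (coreLevel n 1),
      (∀ v : core n,
        Tendsto (fun k => tensor (quot (seq u)) k) atTop (𝓝 (v : CuntzAlgebra n)) →
        ∃ hv : (v : CuntzAlgebra n) ∈ unitary (CuntzAlgebra n),
          Function.Bijective (lam ⟨(v : CuntzAlgebra n), hv⟩) ∧
          ∀ x : core n, lam ⟨(v : CuntzAlgebra n), hv⟩ (x : CuntzAlgebra n)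
            = (productAut u x : CuntzAlgebra n)) ∧
      ((∃ ρ : CuntzAlgebra n →⋆ₐ[ℂ] CuntzAlgebra n,
          ∀ x : core n, ρ (x : CuntzAlgebra n) = (productAut u x : CuntzAlgebra n)) →
        ∃ θ : ℕ → ℝ, ∃ v : core n,
          Tendsto (fun k => tensor (quot fun j => Complex.exp (θ j * Complex.I) • seq u j) k)
            atTop (𝓝 (v : CuntzAlgebra n)))) ∧
    ¬ Function.Surjective (restrict n) :=
  ⟨fun u => ⟨lam_of_tendsto u, fun ⟨_, hρ⟩ => exists_tendsto_of_extends hn hρ⟩,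
    not_surjective_restrict hn⟩
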